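/- Given two sets $\mathcal{L}_1$ and $\mathcal{L}_2$ of $t$ lines each in the Euclidean plane, let $P_0=\{\ell_1\cap\ell_2:\ell_1\in\mathcal{L}_1,\ \ell_2\in\mathcal{L}_2\}$ be the set of intersection points of a line of $\mathcal{L}_1$ with a line of $\mathcal{L}_2$. We say that $(P_0,\mathcal{L}_1\cup\mathcal{L}_2)$ is a natural $t\times t$ grid if $|P_0|=t^2$ and, for $i=1,2$, the convex hull of $P_0$ contains no intersection point of two distinct lines of $\mathcal{L}_i$. A pair $(P,\mathcal{L})$ of a finite set of points and a finite set of lines contains a natural $t\times t$ grid if there is such a grid with $P_0\subseteq P$ and $\mathcal{L}_1\cup\mathcal{L}_2\subseteq\mathcal{L}$. Theorem. There are an absolute constant $c>0$ and, for every integer $t>1$, real numbers $\varepsilon(t)\ge c/t^2$ and $C(t)>0$ such that the following holds. If $P$ is a set of $n$ points and $\mathcal{L}$ a set of $n$ lines in the plane such that $(P,\mathcal{L})$ contains no natural $t\times t$ grid, then $$|\{(p,\ell)\in P\times\mathcal{L}: p\in\ell\}|\le C(t)\, n^{\frac43-\varepsilon(t)}.$$ -/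

import Mathlib

/-- The Euclidean plane. -/
abbrev Plane : Type := EuclideanSpace ℝ (Fin 2)

/-- A line in the plane: an affine subspace whose direction has dimension one. -/
def IsLine (ℓ : AffineSubspace ℝ Plane) : Prop :=
  Module.finrank ℝ ℓ.direction = 1

/-- The set of incidences between a set of points and a set of lines. -/
def incidences (P : Finset Plane) (L : Finset (AffineSubspace ℝ Plane)) :
    Set (Plane × AffineSubspace ℝ Plane) :=
  {x | x.1 ∈ P ∧ x.2 ∈ L ∧ x.1 ∈ x.2}

/-- The set of all points in which a line of the first family and a line of the second family
intersect. -/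
def gridPoints (L₁ L₂ : Finset (AffineSubspace ℝ Plane)) : Set Plane :=
  {p | ∃ ℓ₁ ∈ L₁, ∃ ℓ₂ ∈ L₂, (ℓ₁ : Set Plane) ∩ (ℓ₂ : Set Plane) = {p}}

/-- No intersection point of two distinct lines of `L` lies in the set `K`. -/
def NoCrossingIn (L : Finset (AffineSubspace ℝ Plane)) (K : Set Plane) : Prop :=
  ∀ ℓ ∈ L, ∀ ℓ' ∈ L, ℓ ≠ ℓ' → ∀ p : Plane, p ∈ ℓ → p ∈ ℓ' → p ∉ K

/-- The families `L₁` and `L₂`, together with their intersection points, form a natural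
`t × t` grid. -/
structure IsNaturalGrid (t : ℕ) (L₁ L₂ : Finset (AffineSubspace ℝ Plane)) : Prop where
  isLine₁ : ∀ ℓ ∈ L₁, IsLine ℓ
  isLine₂ : ∀ ℓ ∈ L₂, IsLine ℓ
  card₁ : L₁.card = t
  card₂ : L₂.card = t
  card_points : (gridPoints L₁ L₂).ncard = t ^ 2
  noCrossing₁ : NoCrossingIn L₁ (convexHull ℝ (gridPoints L₁ L₂))
  noCrossing₂ : NoCrossingIn L₂ (convexHull ℝ (gridPoints L₁ L₂))

/-- The arrangement `(P, L)` contains a natural `t × t` grid. -/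
def ContainsNaturalGrid (t : ℕ) (P : Finset Plane) (L : Finset (AffineSubspace ℝ Plane)) :
    Prop :=
  ∃ L₁ L₂ : Finset (AffineSubspace ℝ Plane),
    IsNaturalGrid t L₁ L₂ ∧ L₁ ⊆ L ∧ L₂ ⊆ L ∧ gridPoints L₁ L₂ ⊆ (P : Set Plane)

/-!
Dualize the plane, so that the non-vertical lines become points; the vertical lines take part in at
most one incidence per point. Clarkson–Shor sampling of vertical decompositions splits the `n` dual
points into groups of `N` points, such that all in all the groups touch `O(n √(n / N))` lines.

Within a group there are at most as many incidences as touching lines and pairs of points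
consecutive on a line. If the latter contain a complete bipartite graph with `2 t` points on one
side and sufficiently many on the other, then Ramsey's theorem, applied to the abscissas in which
the corresponding original lines cross, yields two families of `t` lines that meet each other in
consistent orders. Such a grid is natural: if two lines of one family crossed at `p`, then the line
of the other family that one of them meets closest to `p` would separate `p` from the grid. Without
natural grids there are therefore only `O(N ^ (2 - 1 / (2 t)))` consecutive pairs in a group, by the
Kővári–Sós–Turán theorem, and choosing `N` as `n ^ (1 / 3 + 1 / (9 t))` gives the exponent
`4 / 3 - 1 / (18 t)`.
-/

section Counting

variable {α β : Type*}

/-- Clarkson and Shor's double counting: deleting `l` from a sample `R` of `r + 1` elements leaves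
a sample of `r` elements in conflict with `l`. -/
lemma sum_card_conflict_le_of_card_filter_erase_le [DecidableEq α] {s : Finset α}
    {conf : Finset α → Finset α} {d : ℕ} (hs : ∀ R, conf R ⊆ s) (hdisj : ∀ R, Disjoint R (conf R))
    (hd : ∀ R : Finset α, {a ∈ R | a ∈ conf (R.erase a)}.card ≤ d) (r : ℕ) :
    ∑ R ∈ s.powersetCard r, (conf R).card ≤ d * s.card.choose (r + 1) := by
  calc ∑ R ∈ s.powersetCard r, (conf R).card
      ≤ ∑ R ∈ s.powersetCard (r + 1), {a ∈ R | a ∈ conf (R.erase a)}.card := by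
        rw [← Finset.card_sigma, ← Finset.card_sigma]
        refine Finset.card_le_card_of_injOn (fun z => ⟨insert z.2 z.1, z.2⟩) ?_ ?_
        · rintro ⟨R, a⟩ hz
          simp only [Finset.coe_sigma, Set.mem_sigma_iff, Finset.mem_coe, Finset.mem_powersetCard]
            at hz
          have haR : a ∉ R := Finset.disjoint_right.1 (hdisj R) hz.2
          simp only [Finset.coe_sigma, Set.mem_sigma_iff, Finset.mem_coe, Finset.mem_powersetCard,
            Finset.mem_filter, Finset.erase_insert haR]
          exact ⟨⟨Finset.insert_subset (hs R hz.2) hz.1.1,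
            by rw [Finset.card_insert_of_notMem haR, hz.1.2]⟩, Finset.mem_insert_self _ _, hz.2⟩
        · rintro ⟨R, a⟩ hz ⟨R', a'⟩ hz' heq
          simp only [Finset.coe_sigma, Set.mem_sigma_iff, Finset.mem_coe] at hz hz'
          simp only [Sigma.mk.injEq, heq_eq_eq] at heq
          obtain ⟨hins, rfl⟩ := heq
          rw [← Finset.erase_insert (Finset.disjoint_right.1 (hdisj R) hz.2), hins,
            Finset.erase_insert (Finset.disjoint_right.1 (hdisj R') hz'.2)]
    _ ≤ (s.powersetCard (r + 1)).card * d := Finset.sum_le_card_nsmul _ _ d fun R _ => hd R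
    _ = d * s.card.choose (r + 1) := by rw [Finset.card_powersetCard, mul_comm]

lemma card_mul_card_filter_mem_powersetCard [DecidableEq α] {s : Finset α} {a : α}
    (ha : a ∈ s) (r : ℕ) :
    s.card * {R ∈ s.powersetCard r | a ∈ R}.card = r * s.card.choose r := by
  rcases r with _ | r
  · have : {R ∈ s.powersetCard 0 | a ∈ R} = ∅ := by
      simp only [Finset.powersetCard_zero, Finset.filter_singleton, Finset.notMem_empty, if_false]
    rw [this, Finset.card_empty, mul_zero, zero_mul]
  · have hcard := Finset.card_filter_powersetCard_subset {a} s (r + 1)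
      (Finset.singleton_subset_iff.2 ha) (by rw [Finset.card_singleton]; lia)
    simp only [Finset.singleton_subset_iff, Finset.card_singleton, Nat.add_sub_cancel] at hcard
    obtain ⟨n, hn⟩ := Nat.exists_eq_add_of_lt (Finset.card_pos.2 ⟨a, ha⟩)
    rw [zero_add] at hn
    rw [hcard, hn, Nat.add_sub_cancel, Nat.add_one_mul_choose_eq, mul_comm]

lemma card_mul_card_filter_not_disjoint_powersetCard_le [DecidableEq α] {s D : Finset α}
    (hD : D ⊆ s) (r : ℕ) :
    s.card * {R ∈ s.powersetCard r | ¬Disjoint R D}.card ≤ D.card * (r * s.card.choose r) := by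
  have subset : {R ∈ s.powersetCard r | ¬Disjoint R D} ⊆
      D.biUnion fun a => {R ∈ s.powersetCard r | a ∈ R} := by
    intro R hR
    obtain ⟨hR, hRD⟩ := Finset.mem_filter.1 hR
    obtain ⟨a, haR, haD⟩ := Finset.not_disjoint_iff.1 hRD
    exact Finset.mem_biUnion.2 ⟨a, haD, Finset.mem_filter.2 ⟨hR, haR⟩⟩
  calc s.card * {R ∈ s.powersetCard r | ¬Disjoint R D}.card
      ≤ s.card * ∑ a ∈ D, {R ∈ s.powersetCard r | a ∈ R}.card :=
        Nat.mul_le_mul_left _ ((Finset.card_le_card subset).trans Finset.card_biUnion_le)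
    _ = D.card * (r * s.card.choose r) := by
        rw [Finset.mul_sum, Finset.sum_congr rfl fun a ha =>
          card_mul_card_filter_mem_powersetCard (hD ha) r, Finset.sum_const, smul_eq_mul]

open Classical in
/-- The Kővári–Sós–Turán argument: count pairs of a `y ∈ Y` and `s + 1` of its neighbours, and
apply convexity. -/
lemma sum_card_filter_sub_pow_le {X : Finset α} {Y : Finset β} {E : α → β → Prop} {s S : ℕ}
    (h : ∀ A ⊆ X, A.card = s + 1 → {y ∈ Y | ∀ a ∈ A, E a y}.card ≤ S) :
    (∑ y ∈ Y, {x ∈ X | E x y}.card - s * Y.card) ^ (s + 1) ≤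
      Y.card ^ s * (S * X.card ^ (s + 1)) := by
  set d : β → ℕ := fun y => {x ∈ X | E x y}.card with hd
  have choose_eq : ∀ y, (d y).choose (s + 1) =
      {A ∈ X.powersetCard (s + 1) | ∀ a ∈ A, E a y}.card := by
    intro y
    rw [hd, ← Finset.card_powersetCard]
    congr 1
    ext A
    simp only [Finset.mem_powersetCard, Finset.mem_filter, Finset.subset_iff]
    grind
  have sum_choose_le : ∑ y ∈ Y, (d y).choose (s + 1) ≤ X.card.choose (s + 1) * S := by
    simp_rw [choose_eq]
    have hswap := Finset.sum_card_bipartiteAbove_eq_sum_card_bipartiteBelow (s := Y)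
      (t := X.powersetCard (s + 1)) (fun y (A : Finset α) => ∀ a ∈ A, E a y)
    simp only [Finset.bipartiteAbove, Finset.bipartiteBelow] at hswap
    rw [hswap, ← Finset.card_powersetCard]
    exact Finset.sum_le_card_nsmul _ _ S fun A hA =>
      h A (Finset.mem_powersetCard.1 hA).1 (Finset.mem_powersetCard.1 hA).2
  have sub_le_sum : ∑ y ∈ Y, d y - s * Y.card ≤ ∑ y ∈ Y, (d y - s) := by
    rw [Nat.sub_le_iff_le_add, mul_comm, ← smul_eq_mul, ← Finset.sum_const,
      ← Finset.sum_add_distrib]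
    exact Finset.sum_le_sum fun y _ => le_tsub_add
  calc (∑ y ∈ Y, d y - s * Y.card) ^ (s + 1)
      ≤ (∑ y ∈ Y, (d y - s)) ^ (s + 1) := Nat.pow_le_pow_left sub_le_sum _
    _ ≤ Y.card ^ s * ∑ y ∈ Y, (d y - s) ^ (s + 1) :=
        pow_sum_le_card_mul_sum_pow (fun _ _ => Nat.zero_le _) s
    _ ≤ Y.card ^ s * ∑ y ∈ Y, (s + 1).factorial * (d y).choose (s + 1) := by
        gcongr with y
        rw [← Nat.descFactorial_eq_factorial_mul_choose]
        simpa only [Nat.add_sub_add_right] using Nat.pow_sub_le_descFactorial (d y) (s + 1)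
    _ ≤ Y.card ^ s * ((s + 1).factorial * (X.card.choose (s + 1) * S)) := by
        rw [← Finset.mul_sum]
        gcongr
    _ = Y.card ^ s * (S * X.card.descFactorial (s + 1)) := by
        rw [Nat.descFactorial_eq_factorial_mul_choose]
        ring
    _ ≤ Y.card ^ s * (S * X.card ^ (s + 1)) := by
        gcongr
        exact Nat.descFactorial_le_pow _ _

lemma natCast_le_rpow (n : ℕ) {x : ℝ} (hx : 1 ≤ x) : (n : ℝ) ≤ (n : ℝ) ^ x := by
  rcases n.eq_zero_or_pos with rfl | hn
  · rw [Nat.cast_zero]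
    exact Real.rpow_nonneg le_rfl x
  · exact Real.self_le_rpow_of_one_le (Nat.one_le_cast.2 hn) hx

open Classical in
lemma card_filter_product_le_rpow {X : Finset α} {E : α → α → Prop} {s S : ℕ}
    (h : ∀ A ⊆ X, A.card = s + 1 → {y ∈ X | ∀ a ∈ A, E a y}.card ≤ S) :
    ({z ∈ X ×ˢ X | E z.1 z.2}.card : ℝ) ≤ (s + S) * X.card ^ (2 - 1 / (s + 1) : ℝ) := by
  have hs : 1 / ((s : ℝ) + 1) ≤ 1 := (div_le_one (by positivity)).2 (by simp)
  set p : ℝ := 2 - 1 / (s + 1) with hp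
  set e := {z ∈ X ×ˢ X | E z.1 z.2}.card with he
  have hcount : (e - s * X.card) ^ (s + 1) ≤ X.card ^ s * (S * X.card ^ (s + 1)) := by
    have he' : e = ∑ y ∈ X, {x ∈ X | E x y}.card := by
      simp only [he, Finset.card_filter, Finset.sum_product_right]
    exact he' ▸ sum_card_filter_sub_pow_le h
  have hpow : ((X.card : ℝ) ^ p) ^ (s + 1) = X.card ^ s * X.card ^ (s + 1) := by
    rw [← Real.rpow_mul_natCast (Nat.cast_nonneg _), ← pow_add, ← Real.rpow_natCast]
    congr 1
    rw [hp]
    push_cast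
    field_simp
    ring
  have hsub : ((e - s * X.card : ℕ) : ℝ) ≤ S * X.card ^ p := by
    refine le_of_pow_le_pow_left₀ (Nat.succ_ne_zero s) (by positivity) ?_
    calc ((e - s * X.card : ℕ) : ℝ) ^ (s + 1) ≤ S * (X.card ^ s * X.card ^ (s + 1)) := by
          rw [mul_left_comm]
          exact_mod_cast hcount
      _ ≤ S ^ (s + 1) * (X.card ^ s * X.card ^ (s + 1)) := by
          gcongr
          exact_mod_cast Nat.le_self_pow (Nat.succ_ne_zero s) S
      _ = (S * X.card ^ p) ^ (s + 1) := by rw [mul_pow, hpow]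
  have hcard : (X.card : ℝ) ≤ X.card ^ p := natCast_le_rpow _ (by linarith)
  have hsplit : (e : ℝ) ≤ (e - s * X.card : ℕ) + s * X.card := by exact_mod_cast le_tsub_add
  linarith [mul_le_mul_of_nonneg_left hcard (Nat.cast_nonneg (α := ℝ) s)]

open Classical in
lemma card_le_one_add_card_filter_consecutive [LinearOrder β] {S : Finset α} {f : α → β}
    (hf : Set.InjOn f S) :
    S.card ≤ 1 + {z ∈ S ×ˢ S | f z.1 < f z.2 ∧ ∀ c ∈ S, ¬(f z.1 < f c ∧ f c < f z.2)}.card := by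
  rcases S.eq_empty_or_nonempty with rfl | h
  · exact Nat.zero_le _
  obtain ⟨M, hM, hmax⟩ := Finset.exists_max_image S f h
  have hsucc : ∀ a ∈ S.erase M, ∃ b ∈ S, f a < f b ∧ ∀ c ∈ S, ¬(f a < f c ∧ f c < f b) := by
    intro a ha
    obtain ⟨haM, ha⟩ := Finset.mem_erase.1 ha
    have hlt : f a < f M := (hmax a ha).lt_of_ne fun h => haM (hf ha hM h)
    obtain ⟨b, hb, hmin⟩ := Finset.exists_min_image {b ∈ S | f a < f b} f
      ⟨M, Finset.mem_filter.2 ⟨hM, hlt⟩⟩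
    simp only [Finset.mem_filter] at hb hmin
    exact ⟨b, hb.1, hb.2, fun c hc hac => (hmin c ⟨hc, hac.1⟩).not_gt hac.2⟩
  choose! next hmem hlt hgap using hsucc
  rw [← Finset.card_erase_add_one hM, add_comm]
  refine Nat.add_le_add_left (Finset.card_le_card_of_injOn (fun a => (a, next a)) ?_ ?_) 1
  · intro a ha
    exact Finset.mem_filter.2 ⟨Finset.mem_product.2 ⟨Finset.mem_of_mem_erase ha, hmem a ha⟩,
      hlt a ha, hgap a ha⟩
  · intro a _ b _ hab
    exact congrArg Prod.fst hab

end Counting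

section Ramsey

variable {α β : Type*}

lemma exists_insert_pairwise {r : β → β → Prop} [Std.Symm r] {B C : Finset β} {x : β} (hx : x ∈ B)
    (hC : ∀ y ∈ C, (y ≠ x ∧ y ∈ B) ∧ r x y) (hpair : (C : Set β).Pairwise r) :
    ∃ D ⊆ B, D.card = C.card + 1 ∧ (D : Set β).Pairwise r := by
  classical
  refine ⟨insert x C, Finset.insert_subset hx fun y hy => (hC y hy).1.2,
    Finset.card_insert_of_notMem fun h => (hC x h).1.1 rfl, ?_⟩
  rw [Finset.coe_insert]
  exact hpair.insert_of_symm fun y hy _ => (hC y hy).2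

lemma exists_pairwise_or_pairwise_not {r : β → β → Prop} [hr : Std.Symm r] (m n : ℕ)
    {B : Finset β} (hB : (m + n).choose m ≤ B.card) :
    (∃ C ⊆ B, C.card = m ∧ (C : Set β).Pairwise r) ∨
      ∃ C ⊆ B, C.card = n ∧ (C : Set β).Pairwise fun b b' => ¬r b b' := by
  classical
  have hr' : Std.Symm fun b b' => ¬r b b' := ⟨fun b b' h h' => h (hr.symm _ _ h')⟩
  induction m generalizing n B with
  | zero => exact .inl ⟨∅, B.empty_subset, rfl, by simp⟩
  | succ m ihm =>
  induction n generalizing B with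
  | zero => exact .inr ⟨∅, B.empty_subset, rfl, by simp⟩
  | succ n ihn =>
  have hchoose : (m + 1 + (n + 1)).choose (m + 1) =
      (m + (n + 1)).choose m + (m + 1 + n).choose (m + 1) := by
    rw [show m + 1 + (n + 1) = m + (n + 1) + 1 by ring, Nat.choose_succ_succ',
      show m + 1 + n = m + (n + 1) by ring]
  obtain ⟨x, hx⟩ := Finset.card_pos.1 ((Nat.choose_pos (by lia)).trans_le hB)
  have hsplit := Finset.card_filter_add_card_filter_not (s := B.erase x) (r x)
  rw [Finset.card_erase_of_mem hx] at hsplit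
  have subset_of_subset_filter : ∀ {p : β → Prop} [DecidablePred p] {C},
      C ⊆ {y ∈ B.erase x | p y} → C ⊆ B :=
    fun hC => hC.trans ((Finset.filter_subset _ _).trans (B.erase_subset x))
  have mem_of_subset_filter : ∀ {p : β → Prop} [DecidablePred p] {C},
      C ⊆ {y ∈ B.erase x | p y} → ∀ y ∈ C, (y ≠ x ∧ y ∈ B) ∧ p y := fun hC y hy => by
    simpa only [Finset.mem_filter, Finset.mem_erase] using hC hy
  rcases le_or_gt ((m + (n + 1)).choose m) {y ∈ B.erase x | r x y}.card with hbig | hsmall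
  · rcases ihm (n + 1) hbig with ⟨C, hC, rfl, hpair⟩ | ⟨C, hC, hn, hpair⟩
    · exact .inl (exists_insert_pairwise hx (mem_of_subset_filter hC) hpair)
    · exact .inr ⟨C, subset_of_subset_filter hC, hn, hpair⟩
  · rcases ihn (B := {y ∈ B.erase x | ¬r x y}) (by lia) with
      ⟨C, hC, hm, hpair⟩ | ⟨C, hC, rfl, hpair⟩
    · exact .inl ⟨C, subset_of_subset_filter hC, hm, hpair⟩
    · exact .inr (exists_insert_pairwise hx (mem_of_subset_filter hC) hpair)

lemma exists_subset_forall_pairwise_or_pairwise_not {r : α → β → β → Prop}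
    [∀ a, Std.Symm (r a)] (t : ℕ) (A : Finset α) {B : Finset β}
    (hB : Nat.centralBinom^[A.card] t ≤ B.card) :
    ∃ C ⊆ B, C.card = t ∧ ∀ a ∈ A,
      (C : Set β).Pairwise (r a) ∨ (C : Set β).Pairwise fun b b' => ¬r a b b' := by
  classical
  induction A using Finset.induction_on generalizing B with
  | empty =>
    obtain ⟨C, hC, hCt⟩ := Finset.exists_subset_card_eq hB
    exact ⟨C, hC, hCt, by simp⟩
  | insert a A ha ih =>
    rw [Finset.card_insert_of_notMem ha, Function.iterate_succ_apply', Nat.centralBinom,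
      two_mul] at hB
    obtain ⟨D, hD, hDcard, hDa⟩ : ∃ D ⊆ B, D.card = Nat.centralBinom^[A.card] t ∧
        ((D : Set β).Pairwise (r a) ∨ (D : Set β).Pairwise fun b b' => ¬r a b b') := by
      rcases exists_pairwise_or_pairwise_not (r := r a) _ _ hB with
        ⟨D, hD, hcard, h⟩ | ⟨D, hD, hcard, h⟩
      · exact ⟨D, hD, hcard, .inl h⟩
      · exact ⟨D, hD, hcard, .inr h⟩
    obtain ⟨C, hC, hCt, hCA⟩ := ih hDcard.ge
    refine ⟨C, hC.trans hD, hCt, Finset.forall_mem_insert _ _ _ |>.2 ⟨?_, hCA⟩⟩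
    exact hDa.imp (Set.Pairwise.mono hC) (Set.Pairwise.mono hC)

variable {𝕜 : Type*} [CommRing 𝕜] [LinearOrder 𝕜] [IsStrictOrderedRing 𝕜]

lemma mul_pos_of_lt_iff_lt {x x' y y' : 𝕜} (hx : x ≠ x') (hy : y ≠ y')
    (h : x < x' ↔ y < y') : 0 < (x' - x) * (y' - y) := by
  rcases hx.lt_or_gt with hlt | hgt
  · exact mul_pos (sub_pos.2 hlt) (sub_pos.2 (h.1 hlt))
  · exact mul_pos_of_neg_of_neg (sub_neg.2 hgt)
      (sub_neg.2 (lt_of_le_of_ne (not_lt.1 fun hlt => hgt.not_gt (h.2 hlt)) hy.symm))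

lemma exists_columns_alike {X : α → β → 𝕜} {s : ℕ} {A : Finset α} {B : Finset β}
    (hX : ∀ b ∈ B, Set.InjOn (X · b) A) (hB : 2 ^ A.card ^ 2 * s ≤ B.card) :
    ∃ C ⊆ B, s ≤ C.card ∧ ∀ b ∈ C, ∀ b' ∈ C, (A : Set α).Pairwise fun a a' =>
      0 < (X a' b - X a b) * (X a' b' - X a b') := by
  classical
  set pattern : β → Finset (α × α) := fun b => {z ∈ A ×ˢ A | X z.1 b < X z.2 b}
  obtain ⟨y, -, hy⟩ := Finset.exists_le_card_fiber_of_mul_le_card_of_maps_to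
    (t := (A ×ˢ A).powerset) (f := pattern) (n := s)
    (fun b _ => Finset.mem_powerset.2 (Finset.filter_subset _ _)) (Finset.powerset_nonempty _)
    (by rwa [Finset.card_powerset, Finset.card_product, ← sq])
  refine ⟨_, Finset.filter_subset _ _, hy, fun b hb b' hb' a ha a' ha' hne => ?_⟩
  rw [Finset.mem_filter] at hb hb'
  have hpattern := Finset.ext_iff.1 (hb.2.trans hb'.2.symm) (a, a')
  simp only [pattern, Finset.mem_filter, Finset.mem_product, Finset.mem_coe.1 ha,
    Finset.mem_coe.1 ha', true_and] at hpattern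
  exact mul_pos_of_lt_iff_lt (fun h => hne (hX b hb.1 ha ha' h))
    (fun h => hne (hX b' hb'.1 ha ha' h)) hpattern

lemma mul_pos_of_mul_mul_mul_pos {x y z : 𝕜} (h : 0 < x * z * (y * z)) : 0 < x * y := by
  rw [mul_mul_mul_comm] at h
  exact pos_of_mul_pos_left h (mul_self_nonneg z)

/-- By Ramsey's theorem every row is ordered like a fixed row, or oppositely to it. -/
lemma exists_rows_alike {X : α → β → 𝕜} {s t : ℕ} {A : Finset α} {B : Finset β}
    (hX : ∀ a ∈ A, Set.InjOn (X a) B) (hA : A.card = 2 * t) (ht : 0 < t)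
    (hB : Nat.centralBinom^[A.card] s ≤ B.card) :
    ∃ A' ⊆ A, A'.card = t ∧ ∃ C ⊆ B, C.card = s ∧ ∀ a ∈ A', ∀ a' ∈ A',
      (C : Set β).Pairwise fun b b' => 0 < (X a b' - X a b) * (X a' b' - X a' b) := by
  classical
  obtain ⟨o, ho⟩ := Finset.card_pos.1 (by lia : 0 < A.card)
  set like : α → β → β → Prop := fun a b b' => 0 < (X a b' - X a b) * (X o b' - X o b)
  have like_symm : ∀ a, Std.Symm (like a) := fun a => ⟨fun b b' (h : 0 < _) => by
    rwa [← neg_mul_neg, neg_sub, neg_sub] at h⟩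
  obtain ⟨C, hCB, hCs, hC⟩ :=
    exists_subset_forall_pairwise_or_pairwise_not (r := like) s A hB
  have sub_ne : ∀ a ∈ A, (C : Set β).Pairwise fun b b' => X a b' - X a b ≠ 0 :=
    fun a ha b hb b' hb' hne h => hne (hX a ha (hCB hb) (hCB hb') (sub_eq_zero.1 h).symm)
  rcases le_or_gt t {a ∈ A | (C : Set β).Pairwise (like a)}.card with hbig | hsmall
  · obtain ⟨A', hA', hcard⟩ := Finset.exists_subset_card_eq hbig
    have hlike : ∀ a ∈ A', (C : Set β).Pairwise (like a) :=
      fun a ha => (Finset.mem_filter.1 (hA' ha)).2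
    refine ⟨A', hA'.trans (Finset.filter_subset _ _), hcard, C, hCB, hCs, ?_⟩
    intro a ha a' ha' b hb b' hb' hne
    exact mul_pos_of_mul_mul_mul_pos (mul_pos (hlike a ha hb hb' hne) (hlike a' ha' hb hb' hne))
  · have hunlike : t ≤ {a ∈ A | ¬(C : Set β).Pairwise (like a)}.card := by
      have := Finset.card_filter_add_card_filter_not (s := A) fun a => (C : Set β).Pairwise (like a)
      lia
    obtain ⟨A', hA', hcard⟩ := Finset.exists_subset_card_eq hunlike
    have hneg : ∀ a ∈ A', (C : Set β).Pairwise fun b b' =>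
        (X a b' - X a b) * (X o b' - X o b) < 0 := by
      intro a ha b hb b' hb' hne
      obtain ⟨haA, hnot⟩ := Finset.mem_filter.1 (hA' ha)
      exact (not_lt.1 ((hC a haA).resolve_left hnot hb hb' hne)).lt_of_ne
        (mul_ne_zero (sub_ne a haA hb hb' hne) (sub_ne o ho hb hb' hne))
    refine ⟨A', hA'.trans (Finset.filter_subset _ _), hcard, C, hCB, hCs, ?_⟩
    intro a ha a' ha' b hb b' hb' hne
    exact mul_pos_of_mul_mul_mul_pos
      (mul_pos_of_neg_of_neg (hneg a ha hb hb' hne) (hneg a' ha' hb hb' hne))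

lemma exists_consistent_submatrix {X : α → β → 𝕜} {t : ℕ} {A : Finset α} {B : Finset β}
    (hrow : ∀ a ∈ A, Set.InjOn (X a) B) (hcol : ∀ b ∈ B, Set.InjOn (X · b) A) (ht : 0 < t)
    (hA : A.card = 2 * t) (hB : 2 ^ A.card ^ 2 * Nat.centralBinom^[A.card] t ≤ B.card) :
    ∃ A' ⊆ A, ∃ B' ⊆ B, A'.card = t ∧ B'.card = t ∧
      (∀ a ∈ A', ∀ a' ∈ A', (B' : Set β).Pairwise fun b b' =>
        0 < (X a b' - X a b) * (X a' b' - X a' b)) ∧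
      ∀ b ∈ B', ∀ b' ∈ B', (A' : Set α).Pairwise fun a a' =>
        0 < (X a' b - X a b) * (X a' b' - X a b') := by
  obtain ⟨C, hCB, hCcard, hC⟩ := exists_columns_alike hcol hB
  obtain ⟨A', hA', hA'card, B', hB', hB'card, hrows⟩ :=
    exists_rows_alike (fun a ha => (hrow a ha).mono hCB) hA ht hCcard
  exact ⟨A', hA', B', hB'.trans hCB, hA'card, hB'card, hrows,
    fun b hb b' hb' => (hC b (hB' hb) b' (hB' hb')).mono hA'⟩

end Ramsey

section Lines

variable {𝕜 : Type*} [Field 𝕜]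

/-- The ordinate at abscissa `x` of the nonvertical line `l`, which is encoded throughout by the
pair of its slope and its intercept. -/
def ordinate (l : 𝕜 × 𝕜) (x : 𝕜) : 𝕜 :=
  l.1 * x + l.2

/-- The point `q` lies on the line `l`. -/
def OnLine (q l : 𝕜 × 𝕜) : Prop :=
  q.2 = ordinate l q.1

/-- The abscissa of the crossing of the lines `a` and `b`; junk if they are parallel. -/
def crossX (a b : 𝕜 × 𝕜) : 𝕜 :=
  (b.2 - a.2) / (a.1 - b.1)

/-- The lines `a` and `b` cross at a single point, whose abscissa is in `H`. -/
def CrossOver (a b : 𝕜 × 𝕜) (H : Set 𝕜) : Prop :=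
  a.1 ≠ b.1 ∧ crossX a b ∈ H

lemma crossX_comm (a b : 𝕜 × 𝕜) : crossX a b = crossX b a := by
  rw [crossX, crossX, ← neg_sub, ← neg_sub b.1, neg_div_neg_eq]

lemma crossOver_comm {a b : 𝕜 × 𝕜} {H : Set 𝕜} : CrossOver a b H ↔ CrossOver b a H := by
  rw [CrossOver, CrossOver, crossX_comm, ne_comm]

lemma ordinate_sub_ordinate {a b : 𝕜 × 𝕜} (h : a.1 ≠ b.1) (x : 𝕜) :
    ordinate a x - ordinate b x = (a.1 - b.1) * (x - crossX a b) := by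
  have := sub_ne_zero.2 h
  simp only [ordinate, crossX]
  field_simp
  ring

lemma ordinate_crossX {a b : 𝕜 × 𝕜} (h : a.1 ≠ b.1) :
    ordinate a (crossX a b) = ordinate b (crossX a b) := by
  rw [← sub_eq_zero, ordinate_sub_ordinate h, sub_self, mul_zero]

lemma eq_of_ordinate_eq {a b : 𝕜 × 𝕜} {x : 𝕜} (h : ordinate a x = ordinate b x)
    (h' : a.1 = b.1) : a = b :=
  Prod.ext h' (by simpa only [ordinate, h', add_right_inj] using h)

lemma eq_crossX_of_ordinate_eq {a b : 𝕜 × 𝕜} {x : 𝕜} (hab : a.1 ≠ b.1)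
    (h : ordinate a x = ordinate b x) : x = crossX a b := by
  have := ordinate_sub_ordinate hab x
  rw [h, sub_self, eq_comm, mul_eq_zero] at this
  exact sub_eq_zero.1 (this.resolve_left (sub_ne_zero.2 hab))

lemma OnLine.ordinate_eq {q a b : 𝕜 × 𝕜} (ha : OnLine q a) (hb : OnLine q b) :
    ordinate a q.1 = ordinate b q.1 :=
  Eq.trans (Eq.symm ha) hb

lemma OnLine.fst_ne {q q' l : 𝕜 × 𝕜} (hne : q ≠ q') (hq : OnLine q l) (hq' : OnLine q' l) :
    q.1 ≠ q'.1 :=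
  fun h => hne (Prod.ext h (Eq.trans hq (h ▸ Eq.symm hq')))

lemma OnLine.line_unique {q q' a b : 𝕜 × 𝕜} (hne : q ≠ q') (hqa : OnLine q a)
    (hqa' : OnLine q' a) (hqb : OnLine q b) (hqb' : OnLine q' b) : a = b := by
  refine eq_of_ordinate_eq (hqa.ordinate_eq hqb) (not_not.1 fun h => hqa.fst_ne hne hqa' ?_)
  exact (eq_crossX_of_ordinate_eq h (hqa.ordinate_eq hqb)).trans
    (eq_crossX_of_ordinate_eq h (hqa'.ordinate_eq hqb')).symm

lemma ordinate_units_smul (σ : ℤˣ) (l : 𝕜 × 𝕜) (x : 𝕜) :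
    ordinate (σ • l) x = σ • ordinate l x := by
  rcases Int.units_eq_one_or σ with rfl | rfl
  · simp only [one_smul]
  · simp only [ordinate, Units.neg_smul, one_smul, Prod.fst_neg, Prod.snd_neg]
    ring

lemma crossOver_units_smul {σ : ℤˣ} {a b : 𝕜 × 𝕜} {H : Set 𝕜} :
    CrossOver (σ • a) (σ • b) H ↔ CrossOver a b H := by
  rcases Int.units_eq_one_or σ with rfl | rfl
  · simp only [one_smul]
  · simp only [CrossOver, crossX, Units.neg_smul, one_smul, Prod.fst_neg, Prod.snd_neg, ne_eq,
      neg_inj, neg_sub_neg, ← neg_sub a.2, ← neg_sub b.1, neg_div_neg_eq]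

end Lines

section VerticalDecomposition

variable {𝕜 : Type*} [Field 𝕜]

/-- The germ of the line `l` to the right of the abscissa `x`, in the vertical order: ordinates
are compared first, and ties are broken by the slopes. -/
def germ (x : 𝕜) (l : 𝕜 × 𝕜) : 𝕜 ×ₗ 𝕜 :=
  toLex (ordinate l x, l.1)

lemma germ_injective (x : 𝕜) : Function.Injective (germ x) := by
  intro a b h
  have h := Prod.ext_iff.1 (toLex.injective h)
  exact eq_of_ordinate_eq h.1 h.2

variable [LinearOrder 𝕜]

lemma germ_lt_germ_iff {x : 𝕜} {a b : 𝕜 × 𝕜} :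
    germ x a < germ x b ↔
      ordinate a x < ordinate b x ∨ ordinate a x = ordinate b x ∧ a.1 < b.1 :=
  Prod.Lex.toLex_lt_toLex

lemma germ_lt_germ_of_ordinate_lt {x : 𝕜} {a b : 𝕜 × 𝕜} (h : ordinate a x < ordinate b x) :
    germ x a < germ x b :=
  germ_lt_germ_iff.2 (.inl h)

section Crossings

variable [IsStrictOrderedRing 𝕜] {x x' : 𝕜} {a b : 𝕜 × 𝕜}

lemma crossOver_of_germ_lt_of_ordinate_le (h : germ x a < germ x b) (hx : x < x')
    (h' : ordinate b x' ≤ ordinate a x') : CrossOver a b (Set.Ioc x x') := by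
  have hle : ordinate a x - ordinate b x ≤ 0 := by
    rcases germ_lt_germ_iff.1 h with h | h <;> linarith
  have hslope : b.1 < a.1 := by
    by_contra! hc
    rcases germ_lt_germ_iff.1 h with h | h <;> simp only [ordinate] at h h' <;> nlinarith
  have hpos := sub_pos.2 hslope
  rw [ordinate_sub_ordinate hslope.ne'] at hle
  have hge := sub_nonneg.2 h'
  rw [ordinate_sub_ordinate hslope.ne'] at hge
  have hxX : x ≤ crossX a b := sub_nonpos.1 (nonpos_of_mul_nonpos_right hle hpos)
  refine ⟨hslope.ne', hxX.lt_of_ne fun hX => ?_, sub_nonneg.1 (nonneg_of_mul_nonneg_right hge hpos)⟩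
  have heq : ordinate a x = ordinate b x := by rw [hX, ordinate_crossX hslope.ne']
  rcases germ_lt_germ_iff.1 h with h | h
  · exact h.ne heq
  · exact hslope.asymm h.2

lemma crossOver_of_germ_lt_of_ordinate_lt (h : germ x a < germ x b) (hx : x' < x)
    (h' : ordinate b x' < ordinate a x') : CrossOver a b (Set.Ioc x' x) := by
  refine crossOver_comm.1 <|
    crossOver_of_germ_lt_of_ordinate_le (germ_lt_germ_of_ordinate_lt h') hx ?_
  rcases germ_lt_germ_iff.1 h with h | h
  exacts [h.le, h.1.le]

lemma germ_lt_germ_congr (hab : a ≠ b) (hx : x ≤ x') (hc : ¬CrossOver a b (Set.Ioc x x')) :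
    germ x a < germ x b ↔ germ x' a < germ x' b := by
  rcases hx.eq_or_lt with rfl | hx
  · rfl
  have lt_of_lt : ∀ {a b : 𝕜 × 𝕜}, ¬CrossOver a b (Set.Ioc x x') → germ x a < germ x b →
      germ x' a < germ x' b := fun hc h =>
    germ_lt_germ_of_ordinate_lt <| not_le.1 fun h' =>
      hc (crossOver_of_germ_lt_of_ordinate_le h hx h')
  refine ⟨lt_of_lt hc, fun h => ?_⟩
  rcases ((germ_injective x).ne hab).lt_or_gt with h' | h'
  · exact h'
  · exact absurd h (lt_of_lt (mt crossOver_comm.1 hc) h').asymm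

end Crossings

/-- The line `l` is strictly above the point `q` if `σ = 1`, strictly below it if `σ = -1`. The
reflections `l ↦ σ • l` in the horizontal axis exchange the two sides. -/
def OnSide (σ : ℤˣ) (q l : 𝕜 × 𝕜) : Prop :=
  σ • q.2 < σ • ordinate l q.1

open Classical in
/-- The lines of `R` next to the point `q` on its side `σ`, of which there is at most one: ties
are broken by moving infinitesimally to the right. -/
noncomputable def adjacent (σ : ℤˣ) (R : Finset (𝕜 × 𝕜)) (q : 𝕜 × 𝕜) : Finset (𝕜 × 𝕜) :=
  {l ∈ R | OnSide σ q l ∧ ∀ l' ∈ R, OnSide σ q l' → germ q.1 (σ • l) ≤ germ q.1 (σ • l')}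

/-- The point `q` lies on no line of `R`. -/
def Off (R : Finset (𝕜 × 𝕜)) (q : 𝕜 × 𝕜) : Prop :=
  ∀ l ∈ R, ¬OnLine q l

/-- No line of `R` crosses a line next to `q` over the set of abscissas `H`. -/
def Clear (R : Finset (𝕜 × 𝕜)) (q : 𝕜 × 𝕜) (H : Set 𝕜) : Prop :=
  ∀ σ, ∀ u ∈ adjacent σ R q, ∀ w ∈ R, ¬CrossOver w u H

/-- The points `q` and `q'` lie in the same trapezoid of the vertical decomposition of the
arrangement `R`. -/
structure SameCell (R : Finset (𝕜 × 𝕜)) (q q' : 𝕜 × 𝕜) : Prop where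
  off_left : Off R q
  off_right : Off R q'
  adjacent_eq : ∀ σ, adjacent σ R q = adjacent σ R q'
  clear : Clear R q (Set.uIoc q.1 q'.1)

variable {σ : ℤˣ} {R : Finset (𝕜 × 𝕜)} {q q' l l' u w : 𝕜 × 𝕜} {H H' : Set 𝕜}

lemma mem_adjacent : l ∈ adjacent σ R q ↔ l ∈ R ∧ OnSide σ q l ∧
    ∀ l' ∈ R, OnSide σ q l' → germ q.1 (σ • l) ≤ germ q.1 (σ • l') := by
  simp only [adjacent, Finset.mem_filter]

lemma eq_of_mem_adjacent (h : l ∈ adjacent σ R q) (h' : l' ∈ adjacent σ R q) : l = l' := by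
  rw [mem_adjacent] at h h'
  exact smul_left_cancel σ <| germ_injective q.1 <|
    le_antisymm (h.2.2 l' h'.1 h'.2.1) (h'.2.2 l h.1 h.2.1)

lemma exists_mem_adjacent (hl : l ∈ R) (h : OnSide σ q l) :
    ∃ u ∈ adjacent σ R q, germ q.1 (σ • u) ≤ germ q.1 (σ • l) := by
  classical
  obtain ⟨u, hu, hmin⟩ := Finset.exists_min_image {l ∈ R | OnSide σ q l}
    (fun l => germ q.1 (σ • l)) ⟨l, Finset.mem_filter.2 ⟨hl, h⟩⟩
  simp only [Finset.mem_filter] at hu hmin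
  exact ⟨u, mem_adjacent.2 ⟨hu.1, hu.2, fun l' h1 h2 => hmin l' ⟨h1, h2⟩⟩, hmin l ⟨hl, h⟩⟩

lemma Clear.mono (h : Clear R q H) (hH : H' ⊆ H) : Clear R q H' :=
  fun σ u hu w hw hc => h σ u hu w hw ⟨hc.1, hH hc.2⟩

lemma Clear.congr (h : Clear R q H) (hq : ∀ σ, adjacent σ R q = adjacent σ R q') : Clear R q' H :=
  fun σ u hu => h σ u (hq σ ▸ hu)

lemma SameCell.symm (h : SameCell R q q') : SameCell R q' q :=
  ⟨h.off_right, h.off_left, fun σ => (h.adjacent_eq σ).symm,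
    Set.uIoc_comm q'.1 q.1 ▸ h.clear.congr h.adjacent_eq⟩

section Cells

variable [IsStrictOrderedRing 𝕜]

lemma onSide_neg_iff : OnSide (-σ) q l ↔ σ • ordinate l q.1 < σ • q.2 := by
  rw [OnSide, Units.neg_smul, Units.neg_smul, neg_lt_neg_iff]

lemma onSide_or_onSide_neg (h : ¬OnLine q l) (σ : ℤˣ) :
    OnSide σ q l ∨ OnSide (-σ) q l := by
  rw [onSide_neg_iff]
  exact ((MulAction.injective σ).ne h).lt_or_gt

lemma Off.onSide_neg_iff_germ_lt (hq : Off R q) (hu : u ∈ adjacent σ R q) (hw : w ∈ R) :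
    OnSide (-σ) q w ↔ germ q.1 (σ • w) < germ q.1 (σ • u) := by
  have hu := (mem_adjacent.1 hu).2
  refine ⟨fun h => germ_lt_germ_of_ordinate_lt ?_, fun h => ?_⟩
  · simpa only [ordinate_units_smul] using (onSide_neg_iff.1 h).trans hu.1
  · exact (onSide_or_onSide_neg (hq w hw) σ).resolve_left fun h' => (hu.2 w hw h').not_gt h

lemma adjacent_neg_eq (hq : Off R q) (hq' : Off R q') (hx : q.1 ≤ q'.1)
    (hc : Clear R q' (Set.Ioc q.1 q'.1)) (hu : u ∈ adjacent σ R q) (hu' : u ∈ adjacent σ R q') :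
    adjacent (-σ) R q = adjacent (-σ) R q' := by
  have germ_congr : ∀ τ, ∀ v ∈ adjacent τ R q', ∀ w ∈ R,
      (germ q.1 (τ • w) < germ q.1 (τ • v) ↔ germ q'.1 (τ • w) < germ q'.1 (τ • v)) := by
    intro τ v hv w hw
    rcases eq_or_ne w v with rfl | hwv
    · simp only [lt_irrefl]
    · exact germ_lt_germ_congr ((MulAction.injective τ).ne hwv) hx
        (mt crossOver_units_smul.1 (hc τ v hv w hw))
  have onSide_congr : ∀ w ∈ R, (OnSide (-σ) q w ↔ OnSide (-σ) q' w) := fun w hw => by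
    rw [hq.onSide_neg_iff_germ_lt hu hw, hq'.onSide_neg_iff_germ_lt hu' hw, germ_congr σ u hu' w hw]
  have subset : adjacent (-σ) R q' ⊆ adjacent (-σ) R q := by
    intro d hd
    obtain ⟨hdR, hdq, hmin⟩ := mem_adjacent.1 hd
    refine mem_adjacent.2 ⟨hdR, (onSide_congr d hdR).2 hdq, fun w hw h => ?_⟩
    rw [← not_lt, germ_congr (-σ) d hd w hw, not_lt]
    exact hmin w hw ((onSide_congr w hw).1 h)
  refine subset.antisymm' fun d hd => ?_
  obtain ⟨hdR, hdq, -⟩ := mem_adjacent.1 hd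
  obtain ⟨e, he, -⟩ := exists_mem_adjacent hdR ((onSide_congr d hdR).1 hdq)
  rwa [eq_of_mem_adjacent hd (subset he)]

lemma SameCell.of_mem_adjacent (hq : Off R q) (hq' : Off R q') (hx : q.1 ≤ q'.1)
    (hc : Clear R q' (Set.Ioc q.1 q'.1)) (hu : u ∈ adjacent σ R q) (hu' : u ∈ adjacent σ R q') :
    SameCell R q q' := by
  have adjacent_eq : adjacent σ R q = adjacent σ R q' := Finset.ext fun d =>
    ⟨fun hd => eq_of_mem_adjacent hd hu ▸ hu', fun hd => eq_of_mem_adjacent hd hu' ▸ hu⟩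
  have heq : ∀ τ, adjacent τ R q = adjacent τ R q' := by
    intro τ
    rcases eq_or_ne τ σ with rfl | hτ
    · exact adjacent_eq
    · exact Int.units_ne_iff_eq_neg.1 hτ ▸ adjacent_neg_eq hq hq' hx hc hu hu'
  exact ⟨hq, hq', heq, Set.uIoc_of_le hx ▸ hc.congr fun τ => (heq τ).symm⟩

end Cells

/-- A label for the cell of `q` in the vertical decomposition of `R`: its left wall, given by a
line `w` crossing the line `u` next to `q` on the side `σ`, or, if the cell is unbounded to the
left, the lines next to `q` on each side. -/
def HasLabel (R : Finset (𝕜 × 𝕜)) (q : 𝕜 × 𝕜) :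
    (ℤˣ × (𝕜 × 𝕜) × (𝕜 × 𝕜)) ⊕ (ℤˣ → Option (𝕜 × 𝕜)) → Prop
  | .inl (σ, u, w) => u ∈ adjacent σ R q ∧ CrossOver w u (Set.Iic q.1) ∧
      Clear R q (Set.Ioc (crossX w u) q.1)
  | .inr ν => (∀ σ, adjacent σ R q = (ν σ).toFinset) ∧ Clear R q (Set.Iic q.1)

lemma SameCell.of_hasLabel [IsStrictOrderedRing 𝕜] {k} (hq : Off R q) (hq' : Off R q')
    (h : HasLabel R q k) (h' : HasLabel R q' k) : SameCell R q q' := by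
  wlog hx : q.1 ≤ q'.1 generalizing q q'
  · exact (this hq' hq h' h (le_of_not_ge hx)).symm
  rcases k with ⟨σ, u, w⟩ | ν
  · exact .of_mem_adjacent hq hq' hx (h'.2.2.mono (Set.Ioc_subset_Ioc_left h.2.1.2)) h.1 h'.1
  · have heq : ∀ σ, adjacent σ R q' = adjacent σ R q := fun σ => by rw [h.1, h'.1]
    exact ⟨hq, hq', fun σ => (heq σ).symm,
      Set.uIoc_of_le hx ▸ (h'.2.mono Set.Ioc_subset_Iic_self).congr heq⟩

/-- The labels available for the cells of the vertical decomposition of an arrangement `R`. -/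
def labels {α : Type*} (R : Finset α) : Finset ((ℤˣ × α × α) ⊕ (ℤˣ → Option α)) :=
  (Finset.univ ×ˢ R ×ˢ R).disjSum (Fintype.piFinset fun _ => Finset.insertNone R)

lemma card_labels_le {α : Type*} {R : Finset α} (hR : R.Nonempty) :
    (labels R).card ≤ 6 * R.card ^ 2 := by
  have hR := hR.card_pos
  simp only [labels, Finset.card_disjSum, Finset.card_product, Finset.card_univ,
    Fintype.card_units_int, Fintype.card_piFinset, Finset.card_insertNone, Finset.prod_const]
  nlinarith

lemma exists_adjacent_eq_toFinset (σ : ℤˣ) (R : Finset (𝕜 × 𝕜)) (q : 𝕜 × 𝕜) :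
    ∃ o ∈ Finset.insertNone R, adjacent σ R q = o.toFinset := by
  rcases (adjacent σ R q).eq_empty_or_nonempty with h | ⟨u, hu⟩
  · exact ⟨none, Finset.none_mem_insertNone, h⟩
  · refine ⟨some u, Finset.some_mem_insertNone.2 (mem_adjacent.1 hu).1, ?_⟩
    exact Finset.eq_singleton_iff_unique_mem.2 ⟨hu, fun d hd => eq_of_mem_adjacent hd hu⟩

lemma exists_label (R : Finset (𝕜 × 𝕜)) (q : 𝕜 × 𝕜) : ∃ k ∈ labels R, HasLabel R q k := by
  classical
  set S : Finset (ℤˣ × (𝕜 × 𝕜) × (𝕜 × 𝕜)) :=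
    {z ∈ Finset.univ ×ˢ R ×ˢ R | z.2.1 ∈ adjacent z.1 R q ∧
      CrossOver z.2.2 z.2.1 (Set.Iic q.1)} with hS
  have mem_S : ∀ {σ u w}, (σ, u, w) ∈ S ↔
      w ∈ R ∧ u ∈ adjacent σ R q ∧ CrossOver w u (Set.Iic q.1) := by
    intro σ u w
    simp only [hS, Finset.mem_filter, Finset.mem_product, Finset.mem_univ, true_and]
    exact ⟨fun h => ⟨h.1.2, h.2⟩, fun h => ⟨⟨(mem_adjacent.1 h.2.1).1, h.1⟩, h.2⟩⟩
  rcases S.eq_empty_or_nonempty with hempty | hne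
  · choose ν hν hadj using fun σ => exists_adjacent_eq_toFinset σ R q
    refine ⟨.inr ν, Finset.inr_mem_disjSum.2 (Fintype.mem_piFinset.2 hν), hadj, ?_⟩
    exact fun σ u hu w hw hc => Finset.notMem_empty _ (hempty ▸ mem_S.2 ⟨hw, hu, hc⟩)
  · obtain ⟨⟨σ, u, w⟩, hz, hmax⟩ := Finset.exists_max_image S (fun z => crossX z.2.2 z.2.1) hne
    obtain ⟨hw, hu, hc⟩ := mem_S.1 hz
    refine ⟨.inl (σ, u, w), Finset.inl_mem_disjSum.2 ?_, hu, hc, fun σ' u' hu' w' hw' hc' => ?_⟩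
    · simpa only [Finset.mem_product, Finset.mem_univ, true_and] using ⟨(mem_adjacent.1 hu).1, hw⟩
    · exact (hmax _ (mem_S.2 ⟨hw', hu', hc'.1, hc'.2.2⟩)).not_gt hc'.2.1

/-- The line `l` is the wall over `H` of the cell of `q` on its side `σ`: among the lines of `R`
crossing the line next to `q` over the half-line `H` from `q.1`, it crosses it first. -/
def IsWall (σ : ℤˣ) (R : Finset (𝕜 × 𝕜)) (q : 𝕜 × 𝕜) (H : Set 𝕜) (l : 𝕜 × 𝕜) : Prop :=
  ∃ u ∈ adjacent σ R q, CrossOver l u H ∧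
    ∀ w ∈ R, w ≠ l → CrossOver w u H → |crossX l u - q.1| < |crossX w u - q.1|

lemma IsWall.unique (hl : l ∈ R) (hl' : l' ∈ R) (h : IsWall σ R q H l) (h' : IsWall σ R q H l') :
    l = l' := by
  obtain ⟨u, hu, hc, hmin⟩ := h
  obtain ⟨u', hu', hc', hmin'⟩ := h'
  obtain rfl := eq_of_mem_adjacent hu hu'
  by_contra hne
  exact (hmin l' hl' (Ne.symm hne) hc').asymm (hmin' l hl hne hc)

lemma mem_adjacent_of_mem_adjacent_erase (hu : u ∈ adjacent σ (R.erase l) q)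
    (h : germ q.1 (σ • u) ≤ germ q.1 (σ • l)) : u ∈ adjacent σ R q := by
  obtain ⟨huR, hside, hmin⟩ := mem_adjacent.1 hu
  refine mem_adjacent.2 ⟨Finset.mem_of_mem_erase huR, hside, fun w hw hwq => ?_⟩
  rcases eq_or_ne w l with rfl | hwl
  exacts [h, hmin w (Finset.mem_erase.2 ⟨hwl, hw⟩) hwq]

lemma exists_adjacent_erase_lt (hl : l ∈ R) (hs : OnSide σ q l) (h : l ∉ adjacent σ R q) :
    ∃ u ∈ adjacent σ (R.erase l) q, germ q.1 (σ • u) < germ q.1 (σ • l) := by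
  have h : ∃ v ∈ R, OnSide σ q v ∧ germ q.1 (σ • v) < germ q.1 (σ • l) := by
    by_contra! hc
    exact h (mem_adjacent.2 ⟨hl, hs, hc⟩)
  obtain ⟨v, hvR, hv, hvl⟩ := h
  have hne : v ≠ l := by rintro rfl; exact hvl.false
  obtain ⟨u, hu, huv⟩ := exists_mem_adjacent (Finset.mem_erase.2 ⟨hne, hvR⟩) hv
  exact ⟨u, hu, huv.trans_lt hvl⟩

open Classical in
lemma card_isWall_le_one (σ : ℤˣ) (R : Finset (𝕜 × 𝕜)) (q : 𝕜 × 𝕜) (H : Set 𝕜) :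
    {l ∈ R | IsWall σ R q H l}.card ≤ 1 :=
  Finset.card_le_one.2 fun a ha b hb => by
    rw [Finset.mem_filter] at ha hb
    exact ha.2.unique ha.1 hb.1 hb.2

section Erase

variable [IsStrictOrderedRing 𝕜]

/-- The line `l` separates `q'` from the line `u` next to `q` and `q'`, but does not do so at `q`,
so it crosses `u` between them, and no other line does. -/
lemma SameCell.isWall_of_erase (h : SameCell (R.erase l) q q') (hq' : OnLine q' l)
    (hu : u ∈ adjacent σ (R.erase l) q) (hul : germ q.1 (σ • u) < germ q.1 (σ • l)) :
    IsWall σ R q (Set.Ioi q.1) l ∨ IsWall σ R q (Set.Iic q.1) l := by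
  have huR := mem_adjacent_of_mem_adjacent_erase hu hul.le
  have hlt : ordinate (σ • l) q'.1 < ordinate (σ • u) q'.1 := by
    rw [ordinate_units_smul, ordinate_units_smul, ← show q'.2 = _ from hq']
    exact (mem_adjacent.1 (h.adjacent_eq σ ▸ hu)).2.1
  have hclear : ∀ w ∈ R, w ≠ l → ¬CrossOver w u (Set.uIoc q.1 q'.1) := fun w hw hwl =>
    h.clear σ u hu w (Finset.mem_erase.2 ⟨hwl, hw⟩)
  rcases lt_trichotomy q.1 q'.1 with hx | hx | hx
  · left
    rw [Set.uIoc_of_le hx.le] at hclear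
    have hc := crossOver_units_smul.1 (crossOver_of_germ_lt_of_ordinate_le hul hx hlt.le)
    rw [crossOver_comm] at hc
    refine ⟨u, huR, ⟨hc.1, hc.2.1⟩, fun w hw hwl hw' => ?_⟩
    rw [abs_of_pos (sub_pos.2 hc.2.1), abs_of_pos (sub_pos.2 hw'.2), sub_lt_sub_iff_right]
    exact hc.2.2.trans_lt (not_le.1 fun hle => hclear w hw hwl ⟨hw'.1, hw'.2, hle⟩)
  · exact absurd (germ_lt_germ_of_ordinate_lt (hx ▸ hlt)) hul.asymm
  · right
    rw [Set.uIoc_of_ge hx.le] at hclear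
    have hc := crossOver_units_smul.1 (crossOver_of_germ_lt_of_ordinate_lt hul hx hlt)
    rw [crossOver_comm] at hc
    refine ⟨u, huR, ⟨hc.1, hc.2.2⟩, fun w hw hwl hw' => ?_⟩
    rw [abs_of_nonpos (sub_nonpos.2 hc.2.2), abs_of_nonpos (sub_nonpos.2 hw'.2), neg_lt_neg_iff,
      sub_lt_sub_iff_right]
    exact (not_lt.1 fun hlt => hclear w hw hwl ⟨hw'.1, hlt, hw'.2⟩).trans_lt hc.2.1

lemma SameCell.cases_of_erase (hl : l ∈ R) (h : SameCell (R.erase l) q q')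
    (hq' : OnLine q' l) :
    OnLine q l ∨ ∃ σ, l ∈ adjacent σ R q ∨
      IsWall σ R q (Set.Ioi q.1) l ∨ IsWall σ R q (Set.Iic q.1) l := by
  by_cases hlq : OnLine q l
  · exact .inl hlq
  obtain ⟨σ, hs⟩ : ∃ σ, OnSide σ q l := by
    rcases onSide_or_onSide_neg hlq 1 with h | h
    exacts [⟨_, h⟩, ⟨_, h⟩]
  refine .inr ⟨σ, ?_⟩
  by_cases hadj : l ∈ adjacent σ R q
  · exact .inl hadj
  · obtain ⟨u, hu, hul⟩ := exists_adjacent_erase_lt hl hs hadj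
    exact .inr (h.isWall_of_erase hq' hu hul)

open Classical in
/-- The seven lines are one through `q` and, on each side, the line next to `q` and two walls. -/
lemma card_filter_sameCell_erase_le (R : Finset (𝕜 × 𝕜)) (q : 𝕜 × 𝕜) :
    {l ∈ R | ∃ q', SameCell (R.erase l) q q' ∧ OnLine q' l}.card ≤ 7 := by
  set through := {l ∈ R | OnLine q l ∧ Off (R.erase l) q}
  set nearby : ℤˣ → Finset (𝕜 × 𝕜) := fun σ => adjacent σ R q ∪
    ({l ∈ R | IsWall σ R q (Set.Ioi q.1) l} ∪ {l ∈ R | IsWall σ R q (Set.Iic q.1) l})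
  have through_le : through.card ≤ 1 := Finset.card_le_one.2 fun a ha b hb => by
    simp only [through, Finset.mem_filter] at ha hb
    by_contra hne
    exact ha.2.2 b (Finset.mem_erase.2 ⟨Ne.symm hne, hb.1⟩) hb.2.1
  have nearby_le : ∀ σ, (nearby σ).card ≤ 3 := fun σ => by
    have hadj : (adjacent σ R q).card ≤ 1 :=
      Finset.card_le_one.2 fun a ha b hb => eq_of_mem_adjacent ha hb
    have hunion := Finset.card_union_le (adjacent σ R q)
      ({l ∈ R | IsWall σ R q (Set.Ioi q.1) l} ∪ {l ∈ R | IsWall σ R q (Set.Iic q.1) l})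
    have hwalls := Finset.card_union_le {l ∈ R | IsWall σ R q (Set.Ioi q.1) l}
      {l ∈ R | IsWall σ R q (Set.Iic q.1) l}
    have := card_isWall_le_one σ R q (Set.Ioi q.1)
    have := card_isWall_le_one σ R q (Set.Iic q.1)
    lia
  have subset : {l ∈ R | ∃ q', SameCell (R.erase l) q q' ∧ OnLine q' l} ⊆
      through ∪ Finset.univ.biUnion nearby := by
    intro l hl
    obtain ⟨hl, q', hcell, hq'⟩ := Finset.mem_filter.1 hl
    simp only [through, nearby, Finset.mem_union, Finset.mem_biUnion, Finset.mem_filter,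
      Finset.mem_univ, true_and]
    exact (hcell.cases_of_erase hl hq').imp (fun h => ⟨hl, h, hcell.off_left⟩)
      (Exists.imp fun σ => Or.imp_right (Or.imp (⟨hl, ·⟩) (⟨hl, ·⟩)))
  have hbiUnion := Finset.card_biUnion_le_card_mul Finset.univ nearby 3 fun σ _ => nearby_le σ
  have hunion := Finset.card_union_le through (Finset.univ.biUnion nearby)
  rw [Finset.card_univ, Fintype.card_units_int] at hbiUnion
  have := Finset.card_le_card subset
  lia

end Erase

end VerticalDecomposition

section Incidences

variable {𝕜 : Type*} [Field 𝕜] {Q Λ : Finset (𝕜 × 𝕜)} {r : ℕ}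

open Classical in
/-- The number of incidences between the points of `Q` and the lines of `Λ`. -/
noncomputable def inc (Q Λ : Finset (𝕜 × 𝕜)) : ℕ :=
  ∑ l ∈ Λ, {q ∈ Q | OnLine q l}.card

open Classical in
/-- The lines of `Λ` which contain a point of `g`. -/
noncomputable def touching (Λ g : Finset (𝕜 × 𝕜)) : Finset (𝕜 × 𝕜) :=
  {l ∈ Λ | ∃ q ∈ g, OnLine q l}

open Classical in
lemma inc_eq_sum_points (Q Λ : Finset (𝕜 × 𝕜)) :
    inc Q Λ = ∑ q ∈ Q, {l ∈ Λ | OnLine q l}.card :=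
  (Finset.sum_card_bipartiteAbove_eq_sum_card_bipartiteBelow OnLine).symm

lemma inc_touching (g Λ : Finset (𝕜 × 𝕜)) : inc g (touching Λ g) = inc g Λ := by
  classical
  refine Finset.sum_subset (Finset.filter_subset _ _) fun l hl hlg => ?_
  rw [Finset.card_eq_zero, Finset.filter_eq_empty_iff]
  exact fun q hq hql => hlg (Finset.mem_filter.2 ⟨hl, q, hq, hql⟩)

lemma inc_eq_add_of_subset [DecidableEq 𝕜] {g : Finset (𝕜 × 𝕜)} (hg : g ⊆ Q) :
    inc Q Λ = inc g Λ + inc (Q \ g) Λ := by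
  classical
  rw [inc_eq_sum_points, inc_eq_sum_points, inc_eq_sum_points, add_comm, Finset.sum_sdiff hg]

/-- Two points lie on at most one line, so the incidence graph contains no `K_{2,2}`. -/
lemma sq_inc_sub_card_le (Q Λ : Finset (𝕜 × 𝕜)) :
    (inc Q Λ - Λ.card) ^ 2 ≤ Λ.card * Q.card ^ 2 := by
  classical
  have h : ∀ A ⊆ Q, A.card = 1 + 1 → {l ∈ Λ | ∀ q ∈ A, OnLine q l}.card ≤ 1 := by
    intro A _ hA
    obtain ⟨q, q', hne, rfl⟩ := Finset.card_eq_two.1 hA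
    refine Finset.card_le_one.2 fun a ha b hb => ?_
    simp only [Finset.mem_filter, Finset.forall_mem_insert, Finset.mem_singleton, forall_eq]
      at ha hb
    exact ha.2.1.line_unique hne ha.2.2 hb.2.1 hb.2.2
  simpa only [one_mul, pow_one, one_add_one_eq_two, inc] using sum_card_filter_sub_pow_le h

lemma four_mul_inc_le (hQ : 8 * r ≤ Q.card) (hΛ : 64 * r ^ 2 ≤ Λ.card) :
    4 * r * inc Q Λ ≤ Q.card * Λ.card := by
  have hsq : (8 * r * (inc Q Λ - Λ.card)) ^ 2 ≤ (Q.card * Λ.card) ^ 2 :=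
    calc (8 * r * (inc Q Λ - Λ.card)) ^ 2 = 64 * r ^ 2 * (inc Q Λ - Λ.card) ^ 2 := by ring
      _ ≤ Λ.card * (Λ.card * Q.card ^ 2) := Nat.mul_le_mul hΛ (sq_inc_sub_card_le Q Λ)
      _ = (Q.card * Λ.card) ^ 2 := by ring
  have hsub := (Nat.pow_le_pow_iff_left two_ne_zero).1 hsq
  have hcard := Nat.mul_le_mul_right Λ.card hQ
  have hinc := Nat.mul_le_mul_left (8 * r) (le_tsub_add : inc Q Λ ≤ inc Q Λ - Λ.card + Λ.card)
  linarith

lemma inc_le_card_add_mul_sqrt (Q Λ : Finset (𝕜 × 𝕜)) :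
    (inc Q Λ : ℝ) ≤ Λ.card + Q.card * √Λ.card := by
  have hsub : ((inc Q Λ - Λ.card : ℕ) : ℝ) ≤ Q.card * √Λ.card := by
    refine (pow_le_pow_iff_left₀ (Nat.cast_nonneg _) (by positivity) two_ne_zero).1 ?_
    rw [mul_pow, Real.sq_sqrt (Nat.cast_nonneg _), mul_comm]
    exact_mod_cast sq_inc_sub_card_le Q Λ
  have hinc : (inc Q Λ : ℝ) ≤ (inc Q Λ - Λ.card : ℕ) + Λ.card := by
    exact_mod_cast (le_tsub_add : inc Q Λ ≤ inc Q Λ - Λ.card + Λ.card)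
  linarith

variable [LinearOrder 𝕜]

open Classical in
/-- The lines of `Λ` that meet the cell of `q` in the vertical decomposition of `R`. -/
noncomputable def conflict (Λ R : Finset (𝕜 × 𝕜)) (q : 𝕜 × 𝕜) : Finset (𝕜 × 𝕜) :=
  {l ∈ Λ | ∃ q', SameCell R q q' ∧ OnLine q' l}

open Classical in
lemma card_mul_card_filter_not_off_le (Λ : Finset (𝕜 × 𝕜)) (q : 𝕜 × 𝕜) (r : ℕ) :
    Λ.card * {R ∈ Λ.powersetCard r | ¬Off R q}.card ≤
      {l ∈ Λ | OnLine q l}.card * (r * Λ.card.choose r) := by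
  have h : ∀ R ∈ Λ.powersetCard r, (¬Off R q ↔ ¬Disjoint R {l ∈ Λ | OnLine q l}) := by
    intro R hR
    have hRΛ := (Finset.mem_powersetCard.1 hR).1
    simp only [Off, Finset.not_disjoint_iff, Finset.mem_filter]
    push Not
    exact exists_congr fun l => ⟨fun h => ⟨h.1, hRΛ h.1, h.2⟩, fun h => ⟨h.1, h.2.2⟩⟩
  rw [Finset.filter_congr h]
  exact card_mul_card_filter_not_disjoint_powersetCard_le (Finset.filter_subset _ _) r

open Classical in
lemma four_mul_sum_card_filter_not_off_le (hQ : 8 * r ≤ Q.card) (hΛ : 64 * r ^ 2 ≤ Λ.card) :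
    4 * ∑ q ∈ Q, {R ∈ Λ.powersetCard r | ¬Off R q}.card ≤ Q.card * Λ.card.choose r := by
  rcases Λ.card.eq_zero_or_pos with h | h
  · obtain rfl : r = 0 := by nlinarith
    have : ∀ q ∈ Q, {R ∈ Λ.powersetCard 0 | ¬Off R q}.card = 0 := fun q _ => by
      simp [Finset.filter_singleton, Off]
    rw [Finset.sum_eq_zero this]
    exact Nat.zero_le _
  refine Nat.le_of_mul_le_mul_left ?_ h
  calc Λ.card * (4 * ∑ q ∈ Q, {R ∈ Λ.powersetCard r | ¬Off R q}.card)
      = 4 * ∑ q ∈ Q, Λ.card * {R ∈ Λ.powersetCard r | ¬Off R q}.card := by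
        rw [← Finset.mul_sum]; ring
    _ ≤ 4 * ∑ q ∈ Q, {l ∈ Λ | OnLine q l}.card * (r * Λ.card.choose r) :=
        Nat.mul_le_mul_left 4 <|
          Finset.sum_le_sum fun q _ => card_mul_card_filter_not_off_le Λ q r
    _ = 4 * r * inc Q Λ * Λ.card.choose r := by
        rw [← Finset.sum_mul, ← inc_eq_sum_points]; ring
    _ ≤ Q.card * Λ.card * Λ.card.choose r := Nat.mul_le_mul_right _ (four_mul_inc_le hQ hΛ)
    _ = Λ.card * (Q.card * Λ.card.choose r) := by ring

section Sampling

variable [IsStrictOrderedRing 𝕜]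

lemma sum_card_conflict_le (Λ : Finset (𝕜 × 𝕜)) (q : 𝕜 × 𝕜) (r : ℕ) :
    ∑ R ∈ Λ.powersetCard r, (conflict Λ R q).card ≤ 7 * Λ.card.choose (r + 1) := by
  classical
  refine sum_card_conflict_le_of_card_filter_erase_le (fun R => Finset.filter_subset _ _)
    (fun R => Finset.disjoint_right.2 fun l hl hlR => ?_) (fun R => ?_) r
  · obtain ⟨-, q', hcell, hq'⟩ := Finset.mem_filter.1 hl
    exact hcell.off_right l hlR hq'
  · refine (Finset.card_le_card fun l hl => ?_).trans (card_filter_sameCell_erase_le R q)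
    obtain ⟨hlR, hl⟩ := Finset.mem_filter.1 hl
    exact Finset.mem_filter.2 ⟨hlR, (Finset.mem_filter.1 hl).2⟩

lemma sum_mul_card_conflict_le (Λ : Finset (𝕜 × 𝕜)) (q : 𝕜 × 𝕜) (r : ℕ) :
    ∑ R ∈ Λ.powersetCard r, r * (conflict Λ R q).card ≤ 7 * Λ.card * Λ.card.choose r := by
  rw [← Finset.mul_sum]
  calc r * ∑ R ∈ Λ.powersetCard r, (conflict Λ R q).card
      ≤ (r + 1) * (7 * Λ.card.choose (r + 1)) :=
        Nat.mul_le_mul r.le_succ (sum_card_conflict_le Λ q r)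
    _ = 7 * (Λ.card.choose r * (Λ.card - r)) := by rw [← Nat.choose_succ_right_eq]; ring
    _ ≤ 7 * (Λ.card.choose r * Λ.card) := by gcongr; exact Nat.sub_le _ _
    _ = 7 * Λ.card * Λ.card.choose r := by ring

open Classical in
lemma card_filter_lt_conflict_le (Λ : Finset (𝕜 × 𝕜)) (q : 𝕜 × 𝕜) (r : ℕ) :
    4 * {R ∈ Λ.powersetCard r | 28 * Λ.card < r * (conflict Λ R q).card}.card ≤
      Λ.card.choose r := by
  rcases Λ.card.eq_zero_or_pos with hΛ | hΛ
  · rw [Finset.card_eq_zero] at hΛ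
    simp [hΛ, conflict]
  refine Nat.le_of_mul_le_mul_left ?_ (Nat.mul_pos (by norm_num : 0 < 7) hΛ)
  refine le_trans ?_ (sum_mul_card_conflict_le Λ q r)
  calc 7 * Λ.card * (4 * {R ∈ Λ.powersetCard r | 28 * Λ.card < r * (conflict Λ R q).card}.card)
      = {R ∈ Λ.powersetCard r | 28 * Λ.card < r * (conflict Λ R q).card}.card •
          (28 * Λ.card) := by rw [smul_eq_mul]; ring
    _ ≤ ∑ R ∈ Λ.powersetCard r with 28 * Λ.card < r * (conflict Λ R q).card,
          r * (conflict Λ R q).card :=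
        Finset.card_nsmul_le_sum _ _ _ fun R hR => (Finset.mem_filter.1 hR).2.le
    _ ≤ _ := Finset.sum_le_sum_of_subset (Finset.filter_subset _ _)

open Classical in
/-- On average, a random sample puts at most a quarter of the points on its lines, and at most a
quarter of them in cells met by many lines. -/
lemma exists_sample (hQ : 8 * r ≤ Q.card) (hΛ : 64 * r ^ 2 ≤ Λ.card) :
    ∃ R ∈ Λ.powersetCard r,
      Q.card ≤ 2 * {q ∈ Q | Off R q ∧ r * (conflict Λ R q).card ≤ 28 * Λ.card}.card := by
  set bad : Finset (𝕜 × 𝕜) → 𝕜 × 𝕜 → Prop := fun R q =>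
    ¬(Off R q ∧ r * (conflict Λ R q).card ≤ 28 * Λ.card) with hbad
  have card_bad : ∀ q, {R ∈ Λ.powersetCard r | bad R q}.card ≤
      {R ∈ Λ.powersetCard r | ¬Off R q}.card +
        {R ∈ Λ.powersetCard r | 28 * Λ.card < r * (conflict Λ R q).card}.card := by
    intro q
    refine le_trans (Finset.card_le_card fun R hR => ?_) (Finset.card_union_le _ _)
    simpa only [hbad, not_and_or, not_le, Finset.filter_or] using hR
  have sum_bad : ∑ R ∈ Λ.powersetCard r, 2 * {q ∈ Q | bad R q}.card ≤
      ∑ _R ∈ Λ.powersetCard r, Q.card := by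
    rw [Finset.sum_const, Finset.card_powersetCard, smul_eq_mul, ← Finset.mul_sum,
      show ∑ R ∈ Λ.powersetCard r, {q ∈ Q | bad R q}.card =
        ∑ q ∈ Q, {R ∈ Λ.powersetCard r | bad R q}.card from
        Finset.sum_card_bipartiteAbove_eq_sum_card_bipartiteBelow bad]
    have hsum := Finset.sum_le_sum fun q (_ : q ∈ Q) => card_bad q
    have hconf := Finset.sum_le_sum fun q (_ : q ∈ Q) => card_filter_lt_conflict_le Λ q r
    rw [Finset.sum_add_distrib] at hsum
    rw [← Finset.mul_sum, Finset.sum_const, smul_eq_mul] at hconf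
    linarith [four_mul_sum_card_filter_not_off_le hQ hΛ]
  have hr : r ≤ Λ.card := by nlinarith
  obtain ⟨R, hR, h⟩ :=
    Finset.exists_le_of_sum_le (Finset.powersetCard_nonempty.2 hr) sum_bad
  refine ⟨R, hR, ?_⟩
  have := Finset.card_filter_add_card_filter_not (s := Q)
    (fun q => Off R q ∧ r * (conflict Λ R q).card ≤ 28 * Λ.card)
  lia

lemma exists_group_of_sample {N : ℕ} (hr : 0 < r) (hN : 0 < N) (hQ : 12 * r ^ 2 * N ≤ Q.card)
    (hΛ : 64 * r ^ 2 ≤ Λ.card) :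
    ∃ g ⊆ Q, g.card = N ∧ r * (touching Λ g).card ≤ 28 * Λ.card := by
  classical
  have hrQ : 8 * r ≤ Q.card := by
    refine le_trans ?_ ((Nat.le_mul_of_pos_right _ hN).trans hQ)
    nlinarith
  obtain ⟨R, hR, hgood⟩ := exists_sample hrQ hΛ
  choose label hlabel hasLabel using exists_label R
  have card_labels : (labels R).card * N ≤
      {q ∈ Q | Off R q ∧ r * (conflict Λ R q).card ≤ 28 * Λ.card}.card := by
    obtain rfl := (Finset.mem_powersetCard.1 hR).2
    have := Nat.mul_le_mul_right N (card_labels_le (Finset.card_pos.1 hr))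
    linarith
  obtain ⟨k, -, hk⟩ := Finset.exists_le_card_fiber_of_mul_le_card_of_maps_to
    (fun q _ => hlabel q) ⟨_, hlabel 0⟩ card_labels
  obtain ⟨g, hg, rfl⟩ := Finset.exists_subset_card_eq hk
  simp only [Finset.subset_iff, Finset.mem_filter] at hg
  obtain ⟨q, hq⟩ := Finset.card_pos.1 hN
  refine ⟨g, fun q hq => (hg hq).1.1, rfl, le_trans ?_ (hg hq).1.2.2⟩
  refine Nat.mul_le_mul_left _ (Finset.card_le_card fun l hl => ?_)
  obtain ⟨hl, q', hq', hql⟩ := Finset.mem_filter.1 hl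
  have hcell : SameCell R q q' := .of_hasLabel (hg hq).1.2.1 (hg hq').1.2.1
    ((hg hq).2 ▸ hasLabel q) ((hg hq').2 ▸ hasLabel q')
  exact Finset.mem_filter.2 ⟨hl, q', hcell, hql⟩

lemma exists_group {N : ℕ} (hN : 0 < N) (hQ : 64 * N ≤ Q.card) (hΛ : Q.card ≤ Λ.card) :
    ∃ g ⊆ Q, g.card = N ∧ ((touching Λ g).card : ℝ) * √Q.card ≤ 448 * Λ.card * √N := by
  set r := Nat.sqrt (Q.card / (64 * N)) with hr_def
  have hpos : 0 < 64 * N := by lia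
  have hr : 0 < r := Nat.sqrt_pos.2 (Nat.div_pos hQ hpos)
  have le_card : r * r * (64 * N) ≤ Q.card :=
    (Nat.mul_le_mul_right _ (Nat.sqrt_le _)).trans (Nat.div_mul_le_self _ _)
  have card_lt : Q.card < (r + 1) * (r + 1) * (64 * N) :=
    (Nat.div_lt_iff_lt_mul hpos).1 (Nat.lt_succ_sqrt _)
  obtain ⟨g, hg, hgN, hgΛ⟩ := exists_group_of_sample (Q := Q) (Λ := Λ) hr hN (by linarith)
    (by nlinarith [Nat.le_mul_of_pos_right (r * r) hN])
  refine ⟨g, hg, hgN, ?_⟩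
  have sqrt_card_le : √(Q.card : ℝ) ≤ 16 * r * √N := by
    rw [Real.sqrt_le_left (by positivity), mul_pow, Real.sq_sqrt (Nat.cast_nonneg _)]
    have : Q.card ≤ (16 * r) ^ 2 * N := by
      have : (r + 1) * (r + 1) ≤ 4 * (r * r) := by nlinarith
      nlinarith [Nat.mul_le_mul_right (64 * N) this]
    exact_mod_cast this
  calc ((touching Λ g).card : ℝ) * √Q.card ≤ (touching Λ g).card * (16 * r * √N) := by gcongr
    _ = (r * (touching Λ g).card : ℕ) * (16 * √N) := by push_cast; ring
    _ ≤ (28 * Λ.card : ℕ) * (16 * √N) := by gcongr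
    _ = 448 * Λ.card * √N := by push_cast; ring

end Sampling

section Groups

lemma sqrt_div_sqrt_add_le {N k : ℝ} (hN : 0 < N) (hk : 0 ≤ k) :
    √N / √(k + N) ≤ 2 * (√(k + N) / √N - √k / √N) := by
  have hsum : 0 < √(k + N) := Real.sqrt_pos.2 (by linarith)
  have hmono : √k ≤ √(k + N) := Real.sqrt_le_sqrt (by linarith)
  rw [← sub_div, div_le_iff₀ hsum, mul_assoc, div_mul_eq_mul_div, mul_div_assoc',
    le_div_iff₀ (Real.sqrt_pos.2 hN)]
  nlinarith [Real.mul_self_sqrt hN.le, Real.mul_self_sqrt hk,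
    Real.mul_self_sqrt (show 0 ≤ k + N by linarith)]

variable [IsStrictOrderedRing 𝕜]

/-- Remove groups of `N` points each touching few lines, until few points are left. The lines
touched by the groups contribute a telescoping sum of differences of square roots. -/
lemma inc_le_of_groups {N : ℕ} (hN : 0 < N) {E : ℝ} (hE : 0 ≤ E) (hQ : Q.card ≤ Λ.card)
    (h : ∀ g ⊆ Q, g.card = N → (inc g Λ : ℝ) ≤ (touching Λ g).card + E) :
    (inc Q Λ : ℝ) ≤ 896 * Λ.card * (√Q.card / √N) + Q.card / N * E +
      64 * N * √Λ.card + Λ.card := by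
  classical
  induction hm : Q.card using Nat.strong_induction_on generalizing Q with
  | _ m ih =>
  subst hm
  have hN' : (0 : ℝ) < N := by exact_mod_cast hN
  rcases lt_or_ge Q.card (64 * N) with hfew | hmany
  · have hfew : (Q.card : ℝ) ≤ 64 * N := by exact_mod_cast hfew.le
    calc (inc Q Λ : ℝ) ≤ Λ.card + Q.card * √Λ.card := inc_le_card_add_mul_sqrt Q Λ
      _ ≤ Λ.card + 64 * N * √Λ.card := by gcongr
      _ ≤ 896 * Λ.card * (√Q.card / √N) + Q.card / N * E + (64 * N * √Λ.card + Λ.card) := by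
        rw [add_comm]
        exact le_add_of_nonneg_left (by positivity)
      _ = _ := by ring
  · obtain ⟨g, hg, hgN, hgΛ⟩ := exists_group hN hmany hQ
    have hcard : (Q \ g).card + N = Q.card := hgN ▸ Finset.card_sdiff_add_card_eq_card hg
    have hrest := ih (Q \ g).card (by lia) (by lia)
      (fun g' hg' => h g' (hg'.trans Finset.sdiff_subset)) rfl
    have hgroup := h g hg hgN
    have hcard' : (Q.card : ℝ) = (Q \ g).card + N := by exact_mod_cast hcard.symm
    have htouch : ((touching Λ g).card : ℝ) ≤
        448 * Λ.card * (2 * (√Q.card / √N - √(Q \ g).card / √N)) := by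
      have hpos : (0 : ℝ) < √Q.card := Real.sqrt_pos.2 (by exact_mod_cast (by lia : 0 < Q.card))
      refine ((le_div_iff₀ hpos).2 hgΛ).trans ?_
      rw [mul_div_assoc, hcard']
      gcongr
      exact sqrt_div_sqrt_add_le hN' (Nat.cast_nonneg _)
    have hgroups : (Q.card : ℝ) / N * E = (Q \ g).card / N * E + E := by
      rw [hcard']
      field_simp
    rw [inc_eq_add_of_subset hg, Nat.cast_add, hgroups]
    linarith

end Groups

section Edges

variable {g : Finset (𝕜 × 𝕜)}

/-- The points `a` and `b` lie, in this order and with no point of `g` between them, on a line of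
`Λ`. -/
def Next (g Λ : Finset (𝕜 × 𝕜)) (a b : 𝕜 × 𝕜) : Prop :=
  ∃ l ∈ Λ, OnLine a l ∧ OnLine b l ∧ a.1 < b.1 ∧
    ∀ c ∈ g, OnLine c l → ¬(a.1 < c.1 ∧ c.1 < b.1)

open Classical in
/-- The pairs of consecutive points of `g` on lines of `Λ`. -/
noncomputable def edges (g Λ : Finset (𝕜 × 𝕜)) : Finset ((𝕜 × 𝕜) × (𝕜 × 𝕜)) :=
  {z ∈ g ×ˢ g | Next g Λ z.1 z.2}

lemma inc_le_card_add_card_edges (g Λ : Finset (𝕜 × 𝕜)) :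
    inc g Λ ≤ Λ.card + (edges g Λ).card := by
  classical
  set S : 𝕜 × 𝕜 → Finset (𝕜 × 𝕜) := fun l => {q ∈ g | OnLine q l}
  set gaps : 𝕜 × 𝕜 → Finset ((𝕜 × 𝕜) × (𝕜 × 𝕜)) := fun l =>
    {z ∈ S l ×ˢ S l | z.1.1 < z.2.1 ∧ ∀ c ∈ S l, ¬(z.1.1 < c.1 ∧ c.1 < z.2.1)}
  have mem_S : ∀ {q l}, q ∈ S l ↔ q ∈ g ∧ OnLine q l := Finset.mem_filter
  have mem_gaps : ∀ {z l}, z ∈ gaps l ↔ (z.1 ∈ S l ∧ z.2 ∈ S l) ∧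
      z.1.1 < z.2.1 ∧ ∀ c ∈ S l, ¬(z.1.1 < c.1 ∧ c.1 < z.2.1) := by
    intro z l
    rw [Finset.mem_filter, Finset.mem_product]
  have card_S : ∀ l, (S l).card ≤ 1 + (gaps l).card := fun l =>
    card_le_one_add_card_filter_consecutive fun q hq q' hq' h => not_not.1 fun hne =>
      (mem_S.1 hq).2.fst_ne hne (mem_S.1 hq').2 h
  have disjoint_gaps : Set.PairwiseDisjoint Λ gaps := by
    refine fun l _ l' _ hne => Finset.disjoint_left.2 fun z hz hz' => hne ?_
    rw [mem_gaps] at hz hz'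
    exact (mem_S.1 hz.1.1).2.line_unique (fun h => hz.2.1.ne (congrArg Prod.fst h))
      (mem_S.1 hz.1.2).2 (mem_S.1 hz'.1.1).2 (mem_S.1 hz'.1.2).2
  have gaps_subset : Λ.biUnion gaps ⊆ edges g Λ := by
    intro z hz
    obtain ⟨l, hl, hz⟩ := Finset.mem_biUnion.1 hz
    obtain ⟨⟨hz1, hz2⟩, hlt, hgap⟩ := mem_gaps.1 hz
    rw [mem_S] at hz1 hz2
    exact Finset.mem_filter.2 ⟨Finset.mem_product.2 ⟨hz1.1, hz2.1⟩, l, hl, hz1.2, hz2.2, hlt,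
      fun c hc hcl => hgap c (mem_S.2 ⟨hc, hcl⟩)⟩
  calc inc g Λ ≤ ∑ l ∈ Λ, (1 + (gaps l).card) := Finset.sum_le_sum fun l _ => card_S l
    _ = Λ.card + (Λ.biUnion gaps).card := by
      rw [Finset.sum_add_distrib, ← Finset.card_eq_sum_ones, Finset.card_biUnion disjoint_gaps]
    _ ≤ Λ.card + (edges g Λ).card := Nat.add_le_add_left (Finset.card_le_card gaps_subset) _

lemma Next.mono {Λ' : Finset (𝕜 × 𝕜)} {a b : 𝕜 × 𝕜} (h : Next g Λ a b) (hΛ : Λ ⊆ Λ') :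
    Next g Λ' a b :=
  h.imp fun _ hl => ⟨hΛ hl.1, hl.2⟩

lemma inc_le_card_touching_add_card_edges (g Λ : Finset (𝕜 × 𝕜)) :
    inc g Λ ≤ (touching Λ g).card + (edges g Λ).card := by
  classical
  rw [← inc_touching]
  refine (inc_le_card_add_card_edges g _).trans (Nat.add_le_add_left (Finset.card_le_card ?_) _)
  exact Finset.monotone_filter_right _ fun z _ hz => hz.mono (Finset.filter_subset _ _)

end Edges

section Exponents

variable [IsStrictOrderedRing 𝕜] {x δ : ℝ}

lemma mul_sqrt_div_sqrt_rpow (hx : 0 < x) :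
    x * (√x / √(x ^ (1 / 3 + 2 * δ / 9))) = x ^ (4 / 3 - δ / 9) := by
  rw [show 4 / 3 - δ / 9 = 1 + (1 / 2 - (1 / 3 + 2 * δ / 9) * (1 / 2)) by ring,
    Real.rpow_add hx 1, Real.rpow_sub hx, Real.rpow_one, Real.sqrt_eq_rpow, Real.sqrt_eq_rpow,
    ← Real.rpow_mul hx.le]

lemma rpow_mul_sqrt_le (hx : 1 ≤ x) (hδ : δ ≤ 1) :
    x ^ (1 / 3 + 2 * δ / 9) * √x ≤ x ^ (4 / 3 - δ / 9) := by
  rw [Real.sqrt_eq_rpow, ← Real.rpow_add (by linarith)]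
  exact Real.rpow_le_rpow_of_exponent_le hx (by linarith)

lemma mul_rpow_one_sub_le {N : ℝ} (hx : 1 ≤ x) (hδ₀ : 0 ≤ δ) (hδ₁ : δ ≤ 1) (hN : 0 ≤ N)
    (hNx : N ≤ 2 * x ^ (1 / 3 + 2 * δ / 9)) :
    x * N ^ (1 - δ) ≤ 2 * x ^ (4 / 3 - δ / 9) := by
  have hx₀ : 0 < x := by linarith
  calc x * N ^ (1 - δ) ≤ x * (2 * x ^ (1 / 3 + 2 * δ / 9)) ^ (1 - δ) := by
        gcongr
    _ = 2 ^ (1 - δ) * x ^ (1 + (1 / 3 + 2 * δ / 9) * (1 - δ)) := by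
        rw [Real.mul_rpow two_pos.le (by positivity), ← Real.rpow_mul hx₀.le, mul_left_comm,
          Real.rpow_add hx₀, Real.rpow_one]
    _ ≤ 2 ^ (1 : ℝ) * x ^ (4 / 3 - δ / 9) := by
        gcongr
        · exact one_le_two
        · linarith
        · nlinarith
    _ = 2 * x ^ (4 / 3 - δ / 9) := by rw [Real.rpow_one]

/-- The groups in `inc_le_of_groups` are taken of size about `#Λ ^ (1 / 3 + 2 δ / 9)`. -/
lemma inc_le_rpow {K : ℝ} (hδ₀ : 0 ≤ δ) (hδ₁ : δ ≤ 1) (hK : 0 ≤ K) (hQ : Q.card ≤ Λ.card)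
    (h : ∀ g ⊆ Q, (inc g Λ : ℝ) ≤ (touching Λ g).card + K * g.card ^ (2 - δ)) :
    (inc Q Λ : ℝ) ≤ (1025 + 2 * K) * Λ.card ^ (4 / 3 - δ / 9) := by
  rcases Λ.eq_empty_or_nonempty with rfl | hΛ
  · simp only [inc, Finset.sum_empty, Nat.cast_zero]
    positivity
  have hn : (1 : ℝ) ≤ Λ.card := by exact_mod_cast hΛ.card_pos
  have hQn : (Q.card : ℝ) ≤ Λ.card := by exact_mod_cast hQ
  set n : ℝ := (Λ.card : ℝ)
  set M : ℝ := n ^ (1 / 3 + 2 * δ / 9)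
  set Z : ℝ := n ^ (4 / 3 - δ / 9)
  set N := ⌈M⌉₊
  have hM : 1 ≤ M := Real.one_le_rpow hn (by positivity)
  have hMN : M ≤ N := Nat.le_ceil M
  have hNM : (N : ℝ) ≤ 2 * M := (Nat.ceil_lt_two_mul (by linarith)).le
  have hN : (0 : ℝ) < N := by linarith
  have hgroups := inc_le_of_groups (E := K * (N : ℝ) ^ (2 - δ)) (Nat.cast_pos.1 hN)
    (by positivity) hQ fun g hg hgN => hgN ▸ h g hg
  have htouching : 896 * n * (√Q.card / √N) ≤ 896 * Z :=
    calc 896 * n * (√Q.card / √N) ≤ 896 * n * (√n / √M) := by gcongr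
      _ = 896 * Z := by rw [mul_assoc, mul_sqrt_div_sqrt_rpow (by linarith)]
  have hedges : Q.card / N * (K * (N : ℝ) ^ (2 - δ)) ≤ 2 * K * Z :=
    calc Q.card / N * (K * (N : ℝ) ^ (2 - δ)) = K * (Q.card * (N : ℝ) ^ (1 - δ)) := by
          rw [show 2 - δ = 1 + (1 - δ) by ring, Real.rpow_add hN, Real.rpow_one]
          field_simp
      _ ≤ K * (n * (N : ℝ) ^ (1 - δ)) := by gcongr
      _ ≤ K * (2 * Z) := mul_le_mul_of_nonneg_left
        (mul_rpow_one_sub_le hn hδ₀ hδ₁ hN.le hNM) hK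
      _ = 2 * K * Z := by ring
  have hfew : 64 * N * √n ≤ 128 * Z :=
    calc 64 * N * √n ≤ 64 * (2 * M) * √n := by gcongr
      _ = 128 * (M * √n) := by ring
      _ ≤ 128 * Z := by
          gcongr
          exact rpow_mul_sqrt_le hn hδ₁
  have hlines : n ≤ Z := Real.self_le_rpow_of_one_le hn (by linarith)
  linarith

end Exponents

end Incidences

section Grids

variable {𝕜 : Type*} [Field 𝕜]

/-- Point–line duality: `dual` maps points to lines and lines to points. It is an involution that
preserves incidences. -/
def dual (p : 𝕜 × 𝕜) : 𝕜 × 𝕜 :=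
  (-p.1, p.2)

/-- The crossing point of the lines `a` and `b`; junk if they are parallel. -/
def crossPoint (a b : 𝕜 × 𝕜) : 𝕜 × 𝕜 :=
  (crossX a b, ordinate a (crossX a b))

/-- The signed vertical distance from the line `l` up to the point `q`. -/
def height (q l : 𝕜 × 𝕜) : 𝕜 :=
  q.2 - ordinate l q.1

variable {a b l p q : 𝕜 × 𝕜}

lemma dual_dual (p : 𝕜 × 𝕜) : dual (dual p) = p := by
  rw [dual, dual, neg_neg]

lemma dual_injective : Function.Injective (dual : 𝕜 × 𝕜 → 𝕜 × 𝕜) :=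
  Function.Involutive.injective dual_dual

lemma onLine_dual : OnLine a (dual p) ↔ OnLine p a := by
  rw [OnLine, OnLine, ordinate, ordinate, dual, neg_mul, mul_comm p.1, neg_add_eq_sub,
    eq_sub_iff_add_eq, eq_comm, add_comm]

lemma onLine_crossPoint_left (a b : 𝕜 × 𝕜) : OnLine (crossPoint a b) a :=
  rfl

lemma onLine_crossPoint_right (h : a.1 ≠ b.1) : OnLine (crossPoint a b) b :=
  ordinate_crossX h

lemma OnLine.eq_crossPoint (h : a.1 ≠ b.1) (ha : OnLine p a) (hb : OnLine p b) :
    p = crossPoint a b := by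
  have hX := eq_crossX_of_ordinate_eq h (ha.ordinate_eq hb)
  exact Prod.ext hX (Eq.trans ha (congrArg (ordinate a) hX))

lemma crossPoint_comm (h : a.1 ≠ b.1) : crossPoint a b = crossPoint b a :=
  (onLine_crossPoint_right h).eq_crossPoint h.symm (onLine_crossPoint_left a b)

lemma OnLine.eq_dual_crossPoint (h : a.1 ≠ b.1) (ha : OnLine a l) (hb : OnLine b l) :
    l = dual (crossPoint a b) := by
  rw [← dual_dual l] at ha hb
  rw [← (onLine_dual.1 ha).eq_crossPoint h (onLine_dual.1 hb), dual_dual]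

lemma OnLine.height_eq (h : a.1 ≠ b.1) (hq : OnLine q a) :
    height q b = (a.1 - b.1) * (q.1 - crossX a b) := by
  rw [height, hq, ordinate_sub_ordinate h]

variable [LinearOrder 𝕜] {a' b' : 𝕜 × 𝕜} {g Λ : Finset (𝕜 × 𝕜)}

lemma Next.fst_lt (h : Next g Λ a b) : a.1 < b.1 := by
  obtain ⟨_, -, -, -, hlt, -⟩ := h
  exact hlt

lemma Next.dual_crossPoint_mem (h : Next g Λ a b) : dual (crossPoint a b) ∈ Λ := by
  obtain ⟨l, hl, ha, hb, hlt, -⟩ := h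
  rwa [← ha.eq_dual_crossPoint hlt.ne hb]

lemma Next.right_unique (hb : b ∈ g) (hb' : b' ∈ g) (h : Next g Λ a b) (h' : Next g Λ a b')
    (hX : crossX a b = crossX a b') : b = b' := by
  obtain ⟨l, -, hal, hbl, hlt, hgap⟩ := h
  obtain ⟨l', -, hal', hbl', hlt', hgap'⟩ := h'
  have hl : l = l' := by
    rw [hal.eq_dual_crossPoint hlt.ne hbl, hal'.eq_dual_crossPoint hlt'.ne hbl', crossPoint, hX,
      crossPoint]
  subst hl
  by_contra hne
  rcases (hbl.fst_ne hne hbl').lt_or_gt with h | h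
  · exact hgap' b hb hbl ⟨hlt, h⟩
  · exact hgap b' hb' hbl' ⟨hlt', h⟩

lemma Next.left_unique (ha : a ∈ g) (ha' : a' ∈ g) (h : Next g Λ a b) (h' : Next g Λ a' b)
    (hX : crossX a b = crossX a' b) : a = a' := by
  obtain ⟨l, -, hal, hbl, hlt, hgap⟩ := h
  obtain ⟨l', -, hal', hbl', hlt', hgap'⟩ := h'
  have hl : l = l' := by
    rw [hbl.eq_dual_crossPoint hlt.ne' hal, hbl'.eq_dual_crossPoint hlt'.ne' hal', crossPoint,
      crossX_comm, hX, crossX_comm, crossPoint]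
  subst hl
  by_contra hne
  rcases (hal.fst_ne hne hal').lt_or_gt with h | h
  · exact hgap a' ha' hal' ⟨h, hlt'⟩
  · exact hgap' a ha hal ⟨h, hlt⟩

variable {A B : Finset (𝕜 × 𝕜)}

/-- The lines of `A` are all steeper or all less steep than the lines of `B`, they meet the lines
of `B` in the same horizontal order, and vice versa. -/
structure IsConsistentGrid (A B : Finset (𝕜 × 𝕜)) : Prop where
  slope : ∀ a ∈ A, ∀ a' ∈ A, ∀ b ∈ B, ∀ b' ∈ B, 0 < (b.1 - a.1) * (b'.1 - a'.1)
  left : ∀ b ∈ B, ∀ b' ∈ B, (A : Set (𝕜 × 𝕜)).Pairwise fun a a' =>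
    0 < (crossX a' b - crossX a b) * (crossX a' b' - crossX a b')
  right : ∀ a ∈ A, ∀ a' ∈ A, (B : Set (𝕜 × 𝕜)).Pairwise fun b b' =>
    0 < (crossX a b' - crossX a b) * (crossX a' b' - crossX a' b)

namespace IsConsistentGrid

lemma fst_ne (h : IsConsistentGrid A B) (ha : a ∈ A) (hb : b ∈ B) : a.1 ≠ b.1 :=
  (sub_ne_zero.1 (left_ne_zero_of_mul (h.slope a ha a ha b hb b hb).ne')).symm

protected lemma symm (h : IsConsistentGrid A B) : IsConsistentGrid B A where
  slope b hb b' hb' a ha a' ha' := by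
    rw [← neg_sub b.1, ← neg_sub b'.1, neg_mul_neg]
    exact h.slope a ha a' ha' b hb b' hb'
  left a ha a' ha' b hb b' hb' hne := by
    simpa only [crossX_comm a, crossX_comm a'] using h.right a ha a' ha' hb hb' hne
  right b hb b' hb' a ha a' ha' hne := by
    simpa only [crossX_comm _ b, crossX_comm _ b'] using h.left b hb b' hb' ha ha' hne

end IsConsistentGrid

variable [IsStrictOrderedRing 𝕜]

lemma exists_isConsistentGrid {t : ℕ} (ht : 0 < t) (hAg : A ⊆ g) (hBg : B ⊆ g)
    (hA : A.card = 2 * t) (hB : 2 ^ A.card ^ 2 * Nat.centralBinom^[A.card] t ≤ B.card)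
    (h : ∀ a ∈ A, ∀ b ∈ B, Next g Λ a b) :
    ∃ A' ⊆ A, ∃ B' ⊆ B, A'.card = t ∧ B'.card = t ∧ IsConsistentGrid A' B' := by
  obtain ⟨A', hA', B', hB', hA't, hB't, hright, hleft⟩ := exists_consistent_submatrix
    (X := crossX)
    (fun a ha b hb b' hb' => (h a ha b hb).right_unique (hBg hb) (hBg hb') (h a ha b' hb'))
    (fun b hb a ha a' ha' => (h a ha b hb).left_unique (hAg ha) (hAg ha') (h a' ha' b hb))
    ht hA hB
  refine ⟨A', hA', B', hB', hA't, hB't, fun a ha a' ha' b hb b' hb' => ?_, hleft, hright⟩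
  have hlt := fun a ha b hb => sub_pos.2 (h a (hA' ha) b (hB' hb)).fst_lt
  exact mul_pos (hlt a ha b hb) (hlt a' ha' b' hb')

namespace IsConsistentGrid

lemma crossX_sub_mul_crossX_sub_pos (h : IsConsistentGrid A B) (ha : a ∈ A) (ha' : a' ∈ A)
    (hne : a ≠ a') (hp : OnLine p a) (hp' : OnLine p a') (hb : b ∈ B) (hb' : b' ∈ B) :
    0 < (crossX a b - p.1) * (crossX a b' - p.1) := by
  have hrel : ∀ b ∈ B, (a'.1 - a.1) * (crossX a b - p.1) =
      (b.1 - a'.1) * (crossX a' b - crossX a b) := fun b hb => by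
    have := (hp.height_eq (h.fst_ne ha hb)).symm.trans (hp'.height_eq (h.fst_ne ha' hb))
    linear_combination this
  refine pos_of_mul_pos_right ?_ (sq_nonneg (a'.1 - a.1))
  calc 0 < ((b.1 - a'.1) * (b'.1 - a'.1)) *
        ((crossX a' b - crossX a b) * (crossX a' b' - crossX a b')) :=
        mul_pos (h.slope a' ha' a' ha' b hb b' hb') (h.left b hb b' hb' ha ha' hne)
    _ = (a'.1 - a.1) ^ 2 * ((crossX a b - p.1) * (crossX a b' - p.1)) := by
        linear_combination (-(a'.1 - a.1) * (crossX a b - p.1)) * hrel b' hb' -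
          ((b'.1 - a'.1) * (crossX a' b' - crossX a b')) * hrel b hb

lemma left_eq_of_crossPoint_eq (h : IsConsistentGrid A B) (ha : a ∈ A) (ha' : a' ∈ A) (hb : b ∈ B)
    (heq : crossPoint a b = crossPoint a' b') : a = a' := by
  by_contra hne
  have := h.crossX_sub_mul_crossX_sub_pos ha ha' hne (onLine_crossPoint_left a b)
    (heq ▸ onLine_crossPoint_left a' b') hb hb
  rw [crossPoint, sub_self, mul_zero] at this
  exact this.false

lemma right_eq_of_crossPoint_eq (h : IsConsistentGrid A B) (ha : a ∈ A) (ha' : a' ∈ A)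
    (hb : b ∈ B) (hb' : b' ∈ B) (heq : crossPoint a b = crossPoint a' b') : b = b' := by
  rw [crossPoint_comm (h.fst_ne ha hb), crossPoint_comm (h.fst_ne ha' hb')] at heq
  exact h.symm.left_eq_of_crossPoint_eq hb hb' ha heq

/-- If two lines of `A` cross at `p`, then the line of `B` that one of them meets closest to `p`
separates `p` from the grid. -/
lemma exists_height_mul_height_nonpos (h : IsConsistentGrid A B) (hB : B.Nonempty) (ha : a ∈ A)
    (ha' : a' ∈ A) (hne : a ≠ a') (hp : OnLine p a) (hp' : OnLine p a') :
    ∃ b ∈ B, height p b ≠ 0 ∧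
      ∀ c ∈ A, ∀ d ∈ B, height p b * height (crossPoint c d) b ≤ 0 := by
  obtain ⟨b, hb, hmin⟩ := B.exists_min_image (fun b => |crossX a b - p.1|) hB
  have hpos := fun d (hd : d ∈ B) => h.crossX_sub_mul_crossX_sub_pos ha ha' hne hp hp' hb hd
  have hbeyond : ∀ d ∈ B, 0 ≤ (crossX a d - crossX a b) * (crossX a b - p.1) := fun d hd => by
    have := mul_le_mul_of_nonneg_left (hmin d hd) (abs_nonneg (crossX a b - p.1))
    rw [← abs_mul, ← abs_mul, abs_of_pos (hpos b hb), abs_of_pos (hpos d hd)] at this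
    linarith
  refine ⟨b, hb, ?_, fun c hc d hd => ?_⟩
  · rw [hp.height_eq (h.fst_ne ha hb), ← neg_sub (crossX a b)]
    exact mul_ne_zero (sub_ne_zero.2 (h.fst_ne ha hb))
      (neg_ne_zero.2 (left_ne_zero_of_mul (hpos b hb).ne'))
  have hbeyond' : 0 ≤ (crossX c d - crossX c b) * (crossX a b - p.1) := by
    rcases eq_or_ne b d with rfl | hne
    · rw [sub_self, zero_mul]
    have hright := h.right a ha c hc hb hd hne
    refine nonneg_of_mul_nonneg_right ?_ (sq_pos_iff.2 (left_ne_zero_of_mul hright.ne'))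
    linear_combination mul_nonneg hright.le (hbeyond d hd)
  rw [hp.height_eq (h.fst_ne ha hb), (onLine_crossPoint_left c d).height_eq (h.fst_ne hc hb)]
  have := mul_nonneg (h.slope a ha c hc b hb b hb).le hbeyond'
  rw [crossPoint]
  linarith

end IsConsistentGrid

/-- The dual image of a natural `t × t` grid: `t` points and `t` points of `Q`, whose dual lines
form a consistent grid, and such that the lines joining the former to the latter are in `Λ`. -/
def ContainsConsistentGrid (t : ℕ) (Q Λ : Finset (𝕜 × 𝕜)) : Prop :=
  ∃ A ⊆ Q, ∃ B ⊆ Q, A.card = t ∧ B.card = t ∧ IsConsistentGrid A B ∧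
    ∀ a ∈ A, ∀ b ∈ B, dual (crossPoint a b) ∈ Λ

lemma exists_card_edges_le_rpow (𝕜 : Type*) [Field 𝕜] [LinearOrder 𝕜] [IsStrictOrderedRing 𝕜]
    {t : ℕ} (ht : 0 < t) :
    ∃ K : ℝ, 0 ≤ K ∧ ∀ g Λ : Finset (𝕜 × 𝕜), ¬ContainsConsistentGrid t g Λ →
      ((edges g Λ).card : ℝ) ≤ K * g.card ^ (2 - 1 / (2 * t) : ℝ) := by
  classical
  obtain ⟨s, hs⟩ : ∃ s, s + 1 = 2 * t := ⟨2 * t - 1, by omega⟩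
  refine ⟨s + (2 ^ (2 * t) ^ 2 * Nat.centralBinom^[2 * t] t : ℕ), by positivity,
    fun g Λ hgrid => ?_⟩
  have hs' : (s + 1 : ℝ) = 2 * t := by exact_mod_cast hs
  rw [← hs']
  refine card_filter_product_le_rpow fun A hA hcard => ?_
  by_contra! hlarge
  rw [hs] at hcard
  set B : Finset (𝕜 × 𝕜) := {b ∈ g | ∀ a ∈ A, Next g Λ a b}
  have hBg : B ⊆ g := Finset.filter_subset _ _
  have hnext : ∀ a ∈ A, ∀ b ∈ B, Next g Λ a b := fun a ha b hb => (Finset.mem_filter.1 hb).2 a ha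
  obtain ⟨A', hA', B', hB', hA't, hB't, hcons⟩ :=
    exists_isConsistentGrid ht hA hBg hcard (hcard ▸ hlarge.le) hnext
  exact hgrid ⟨A', hA'.trans hA, B', hB'.trans hBg, hA't, hB't, hcons,
    fun a ha b hb => (hnext a (hA' ha) b (hB' hb)).dual_crossPoint_mem⟩

lemma exists_inc_le_rpow (𝕜 : Type*) [Field 𝕜] [LinearOrder 𝕜] [IsStrictOrderedRing 𝕜]
    {t : ℕ} (ht : 0 < t) :
    ∃ C : ℝ, 0 < C ∧ ∀ Q Λ : Finset (𝕜 × 𝕜), Q.card ≤ Λ.card → ¬ContainsConsistentGrid t Q Λ →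
      (inc Q Λ : ℝ) ≤ C * Λ.card ^ (4 / 3 - 1 / (18 * t) : ℝ) := by
  obtain ⟨K, hK, hedges⟩ := exists_card_edges_le_rpow 𝕜 ht
  refine ⟨1025 + 2 * K, by positivity, fun Q Λ hQ hgrid => ?_⟩
  have ht' : (1 : ℝ) ≤ t := Nat.one_le_cast.2 ht
  have hδ : 1 / (2 * t : ℝ) ≤ 1 := div_le_one_of_le₀ (by linarith) (by linarith)
  have hexp : 1 / (18 * t : ℝ) = 1 / (2 * t) / 9 := by ring
  rw [hexp]
  refine inc_le_rpow (by positivity) hδ hK hQ fun g hg => ?_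
  have hgrid' : ¬ContainsConsistentGrid t g Λ := fun ⟨A, hA, B, hB, h⟩ =>
    hgrid ⟨A, hA.trans hg, B, hB.trans hg, h⟩
  calc (inc g Λ : ℝ) ≤ (touching Λ g).card + (edges g Λ).card :=
        mod_cast inc_le_card_touching_add_card_edges g Λ
    _ ≤ (touching Λ g).card + K * g.card ^ (2 - 1 / (2 * t) : ℝ) := by
        gcongr
        exact hedges g Λ hgrid'

end Grids

section EuclideanPlane

/-- The coordinates of a point of the plane. -/
noncomputable def coords : Plane ≃ₗ[ℝ] ℝ × ℝ :=
  (WithLp.linearEquiv 2 ℝ (Fin 2 → ℝ)).trans (LinearEquiv.finTwoArrow ℝ ℝ)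

/-- The line of the plane with slope `l.1` and intercept `l.2`. -/
def lineOf (l : ℝ × ℝ) : AffineSubspace ℝ Plane where
  carrier := {p | OnLine (coords p) l}
  smul_vsub_vadd_mem' c p₁ p₂ p₃ h₁ h₂ h₃ := by
    simp only [Set.mem_ofPred_eq, OnLine, ordinate, vsub_eq_sub, vadd_eq_add, map_add, map_smul,
      map_sub, Prod.fst_add, Prod.snd_add, Prod.smul_fst, Prod.smul_snd, Prod.fst_sub,
      Prod.snd_sub, smul_eq_mul] at h₁ h₂ h₃ ⊢
    linear_combination c * h₁ - c * h₂ + h₃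

/-- The line `ℓ` is vertical: its points are those of some fixed abscissa. -/
def IsVertical (ℓ : AffineSubspace ℝ Plane) : Prop :=
  ∃ x, ∀ p, p ∈ ℓ ↔ (coords p).1 = x

lemma mem_lineOf {p : Plane} {l : ℝ × ℝ} : p ∈ lineOf l ↔ OnLine (coords p) l :=
  Iff.rfl

lemma coords_symm_mem_lineOf {q l : ℝ × ℝ} : coords.symm q ∈ lineOf l ↔ OnLine q l := by
  rw [mem_lineOf, LinearEquiv.apply_symm_apply]

lemma lineOf_injective : Function.Injective lineOf := by
  intro a b h
  have on_b : ∀ x, OnLine (x, ordinate a x) b := fun x => by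
    rw [← coords_symm_mem_lineOf, ← h, coords_symm_mem_lineOf, OnLine]
  exact OnLine.line_unique (q := (0, ordinate a 0)) (q' := (1, ordinate a 1))
    (fun h => zero_ne_one (congrArg Prod.fst h)) rfl rfl (on_b 0) (on_b 1)

lemma IsLine.exists_mem_iff {ℓ : AffineSubspace ℝ Plane} (h : IsLine ℓ) :
    ∃ q v : ℝ × ℝ, v ≠ 0 ∧ ∀ p : Plane, p ∈ ℓ ↔ ∃ c : ℝ, coords p = q + c • v := by
  obtain ⟨p₀, hp₀⟩ : (ℓ : Set Plane).Nonempty := by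
    rw [AffineSubspace.nonempty_iff_ne_bot]
    rintro rfl
    rw [IsLine, AffineSubspace.direction_bot, finrank_bot] at h
    exact zero_ne_one h
  obtain ⟨⟨v, hv⟩, hv0, hspan⟩ := finrank_eq_one_iff'.1 h
  refine ⟨coords p₀, coords v, fun hv' => hv0 (Subtype.ext (coords.map_eq_zero_iff.1 hv')),
    fun p => ?_⟩
  rw [← AffineSubspace.vsub_right_mem_direction_iff_mem hp₀, vsub_eq_sub]
  simp only [← map_smul, ← map_add, coords.injective.eq_iff, ← sub_eq_iff_eq_add']
  refine ⟨fun hp => ?_, fun ⟨c, hc⟩ => hc ▸ Submodule.smul_mem _ c hv⟩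
  obtain ⟨c, hc⟩ := hspan ⟨_, hp⟩
  exact ⟨c, (congrArg Subtype.val hc).symm⟩

lemma IsLine.isVertical_or_exists_eq_lineOf {ℓ : AffineSubspace ℝ Plane} (h : IsLine ℓ) :
    IsVertical ℓ ∨ ∃ l, ℓ = lineOf l := by
  obtain ⟨q, v, hv, hmem⟩ := h.exists_mem_iff
  simp only [Prod.ext_iff, Prod.fst_add, Prod.snd_add, Prod.smul_fst, Prod.smul_snd,
    smul_eq_mul] at hmem
  rcases eq_or_ne v.1 0 with hv₁ | hv₁
  · have hv₂ : v.2 ≠ 0 := fun hv₂ => hv (Prod.ext hv₁ hv₂)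
    refine .inl ⟨q.1, fun p => (hmem p).trans ⟨fun ⟨c, hc, _⟩ => ?_, fun hp => ?_⟩⟩
    · rw [hc, hv₁, mul_zero, add_zero]
    · refine ⟨((coords p).2 - q.2) / v.2, by rw [hp, hv₁, mul_zero, add_zero], ?_⟩
      field_simp
      ring
  · refine .inr ⟨(v.2 / v.1, q.2 - v.2 / v.1 * q.1), AffineSubspace.ext fun p => ?_⟩
    rw [mem_lineOf, hmem, OnLine, ordinate]
    refine ⟨fun ⟨c, hc₁, hc₂⟩ => ?_, fun hp => ⟨((coords p).1 - q.1) / v.1, ?_, ?_⟩⟩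
    · rw [hc₁, hc₂]
      field_simp
      ring
    · field_simp
      ring
    · rw [hp]
      field_simp
      ring

section NaturalGrids

variable {A B : Finset (ℝ × ℝ)} {t : ℕ}

/-- The lines of the plane encoded by the elements of `A`. -/
noncomputable def linesOf (A : Finset (ℝ × ℝ)) : Finset (AffineSubspace ℝ Plane) :=
  A.map ⟨lineOf, lineOf_injective⟩

lemma mem_linesOf {ℓ : AffineSubspace ℝ Plane} : ℓ ∈ linesOf A ↔ ∃ a ∈ A, lineOf a = ℓ :=
  Finset.mem_map

lemma card_linesOf (A : Finset (ℝ × ℝ)) : (linesOf A).card = A.card :=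
  Finset.card_map _

lemma lineOf_inter_lineOf {a b : ℝ × ℝ} (h : a.1 ≠ b.1) :
    (lineOf a : Set Plane) ∩ lineOf b = {coords.symm (crossPoint a b)} := by
  ext p
  simp only [Set.mem_inter_iff, SetLike.mem_coe, mem_lineOf, Set.mem_singleton_iff,
    LinearEquiv.eq_symm_apply]
  refine ⟨fun hp => hp.1.eq_crossPoint h hp.2, fun hp => ?_⟩
  rw [hp]
  exact ⟨onLine_crossPoint_left a b, onLine_crossPoint_right h⟩

lemma gridPoints_linesOf (h : ∀ a ∈ A, ∀ b ∈ B, a.1 ≠ b.1) :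
    gridPoints (linesOf A) (linesOf B) =
      (fun z => coords.symm (crossPoint z.1 z.2)) '' (A ×ˢ B : Set ((ℝ × ℝ) × (ℝ × ℝ))) := by
  ext p
  constructor
  · rintro ⟨_, hℓ₁, _, hℓ₂, hp⟩
    obtain ⟨a, ha, rfl⟩ := mem_linesOf.1 hℓ₁
    obtain ⟨b, hb, rfl⟩ := mem_linesOf.1 hℓ₂
    rw [lineOf_inter_lineOf (h a ha b hb), Set.singleton_eq_singleton_iff] at hp
    exact ⟨(a, b), ⟨ha, hb⟩, hp⟩
  · rintro ⟨⟨a, b⟩, ⟨ha, hb⟩, rfl⟩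
    exact ⟨_, mem_linesOf.2 ⟨a, ha, rfl⟩, _, mem_linesOf.2 ⟨b, hb, rfl⟩,
      lineOf_inter_lineOf (h a ha b hb)⟩

lemma gridPoints_comm (L₁ L₂ : Finset (AffineSubspace ℝ Plane)) :
    gridPoints L₁ L₂ = gridPoints L₂ L₁ := by
  ext p
  constructor <;> rintro ⟨ℓ₁, h₁, ℓ₂, h₂, h⟩ <;>
    exact ⟨ℓ₂, h₂, ℓ₁, h₁, Set.inter_comm _ _ ▸ h⟩

lemma convex_setOf_mul_height_nonpos (c : ℝ) (l : ℝ × ℝ) :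
    Convex ℝ {p | c * height (coords p) l ≤ 0} := by
  intro p hp q hq u v hu hv huv
  simp only [Set.mem_ofPred_eq, height, ordinate, map_add, map_smul, Prod.fst_add, Prod.snd_add,
    Prod.smul_fst, Prod.smul_snd, smul_eq_mul] at hp hq ⊢
  linear_combination u * hp + v * hq + c * l.2 * huv

namespace IsConsistentGrid

lemma ncard_gridPoints (h : IsConsistentGrid A B) :
    (gridPoints (linesOf A) (linesOf B)).ncard = A.card * B.card := by
  rw [gridPoints_linesOf fun a ha b hb => h.fst_ne ha hb, Set.InjOn.ncard_image,
    Set.ncard_prod, Set.ncard_coe_finset, Set.ncard_coe_finset]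
  rintro ⟨a, b⟩ ⟨ha, hb⟩ ⟨a', b'⟩ ⟨ha', hb'⟩ heq
  have heq := coords.symm.injective heq
  exact Prod.ext (h.left_eq_of_crossPoint_eq ha ha' hb heq)
    (h.right_eq_of_crossPoint_eq ha ha' hb hb' heq)

lemma noCrossingIn (h : IsConsistentGrid A B) (hB : B.Nonempty) :
    NoCrossingIn (linesOf A) (convexHull ℝ (gridPoints (linesOf A) (linesOf B))) := by
  intro ℓ hℓ ℓ' hℓ' hne p hp hp' hmem
  obtain ⟨a, ha, rfl⟩ := mem_linesOf.1 hℓ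
  obtain ⟨a', ha', rfl⟩ := mem_linesOf.1 hℓ'
  obtain ⟨b, -, hpb, hsep⟩ := h.exists_height_mul_height_nonpos hB ha ha'
    (ne_of_apply_ne lineOf hne) (mem_lineOf.1 hp) (mem_lineOf.1 hp')
  have hgrid : gridPoints (linesOf A) (linesOf B) ⊆
      {q | height (coords p) b * height (coords q) b ≤ 0} := by
    rw [gridPoints_linesOf fun a ha b hb => h.fst_ne ha hb]
    rintro _ ⟨⟨c, d⟩, ⟨hc, hd⟩, rfl⟩
    rw [Set.mem_ofPred_eq, LinearEquiv.apply_symm_apply]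
    exact hsep c hc d hd
  exact (mul_self_pos.2 hpb).not_ge
    (convexHull_min hgrid (convex_setOf_mul_height_nonpos _ _) hmem)

lemma isNaturalGrid (h : IsConsistentGrid A B) (ht : 0 < t) (hA : A.card = t) (hB : B.card = t)
    (hA' : ∀ ℓ ∈ linesOf A, IsLine ℓ) (hB' : ∀ ℓ ∈ linesOf B, IsLine ℓ) :
    IsNaturalGrid t (linesOf A) (linesOf B) where
  isLine₁ := hA'
  isLine₂ := hB'
  card₁ := (card_linesOf A).trans hA
  card₂ := (card_linesOf B).trans hB
  card_points := by rw [h.ncard_gridPoints, hA, hB, sq]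
  noCrossing₁ := h.noCrossingIn (Finset.card_pos.1 (hB ▸ ht))
  noCrossing₂ := gridPoints_comm _ _ ▸ h.symm.noCrossingIn (Finset.card_pos.1 (hA ▸ ht))

end IsConsistentGrid

end NaturalGrids

section Dual

variable {P : Finset Plane} {L : Finset (AffineSubspace ℝ Plane)}

/-- The lines dual to the points of `P`. -/
noncomputable def dualLines (P : Finset Plane) : Finset (ℝ × ℝ) :=
  P.map ⟨fun p => dual (coords p), dual_injective.comp coords.injective⟩

/-- The points dual to the nonvertical lines of `L`, that is, the pairs of their slopes and their
intercepts. -/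
noncomputable def dualPoints (L : Finset (AffineSubspace ℝ Plane)) : Finset (ℝ × ℝ) :=
  L.preimage lineOf lineOf_injective.injOn

lemma mem_dualLines {l : ℝ × ℝ} : l ∈ dualLines P ↔ ∃ p ∈ P, dual (coords p) = l :=
  Finset.mem_map

lemma card_dualLines (P : Finset Plane) : (dualLines P).card = P.card :=
  Finset.card_map _

lemma linesOf_dualPoints_subset (L : Finset (AffineSubspace ℝ Plane)) :
    linesOf (dualPoints L) ⊆ L := fun _ hℓ => by
  obtain ⟨a, ha, rfl⟩ := mem_linesOf.1 hℓ
  exact Finset.mem_preimage.1 ha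

lemma card_dualPoints_le (L : Finset (AffineSubspace ℝ Plane)) : (dualPoints L).card ≤ L.card :=
  card_linesOf (dualPoints L) ▸ Finset.card_le_card (linesOf_dualPoints_subset L)

lemma ncard_incidences_isVertical_le (P : Finset Plane) (L : Finset (AffineSubspace ℝ Plane)) :
    {z ∈ incidences P L | IsVertical z.2}.ncard ≤ P.card := by
  rw [← Set.ncard_coe_finset]
  refine Set.ncard_le_ncard_of_injOn Prod.fst (fun z hz => hz.1.1) ?_
  rintro ⟨p, ℓ⟩ ⟨⟨-, -, hp⟩, x, hx⟩ ⟨_, ℓ'⟩ ⟨⟨-, -, hp'⟩, x', hx'⟩ (rfl : p = _)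
  refine Prod.ext rfl (AffineSubspace.ext fun q => ?_)
  rw [hx, hx', ← (hx p).1 hp, (hx' p).1 hp']

lemma ncard_incidences_lineOf_le (P : Finset Plane) (L : Finset (AffineSubspace ℝ Plane)) :
    {z ∈ incidences P L | ∃ l, z.2 = lineOf l}.ncard ≤ inc (dualPoints L) (dualLines P) := by
  classical
  set S := (dualLines P).sigma fun l => {q ∈ dualPoints L | OnLine q l}
  have hsub : {z ∈ incidences P L | ∃ l, z.2 = lineOf l} ⊆
      (S.image fun z => (coords.symm (dual z.1), lineOf z.2) : Finset _) := by
    rintro ⟨p, _⟩ ⟨⟨hp, hl, hpl⟩, l, rfl⟩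
    have hS : ⟨dual (coords p), l⟩ ∈ S := Finset.mem_sigma.2 ⟨mem_dualLines.2 ⟨p, hp, rfl⟩,
      Finset.mem_filter.2 ⟨Finset.mem_preimage.2 hl, onLine_dual.2 (mem_lineOf.1 hpl)⟩⟩
    refine Finset.mem_coe.2 (Finset.mem_image.2 ⟨_, hS, ?_⟩)
    simp only [dual_dual, LinearEquiv.symm_apply_apply]
  calc {z ∈ incidences P L | ∃ l, z.2 = lineOf l}.ncard ≤ S.card :=
        (Set.ncard_le_ncard hsub (Finset.finite_toSet _)).trans
          ((Set.ncard_coe_finset _).trans_le Finset.card_image_le)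
    _ = inc (dualPoints L) (dualLines P) := Finset.card_sigma _ _

lemma ncard_incidences_le (hL : ∀ ℓ ∈ L, IsLine ℓ) :
    (incidences P L).ncard ≤ P.card + inc (dualPoints L) (dualLines P) := by
  have hsplit : incidences P L = {z ∈ incidences P L | IsVertical z.2} ∪
      {z ∈ incidences P L | ∃ l, z.2 = lineOf l} := by
    rw [← Set.sep_or, eq_comm, Set.sep_eq_self_iff_mem_true]
    exact fun z hz => (hL z.2 hz.2.1).isVertical_or_exists_eq_lineOf
  rw [hsplit]
  exact (Set.ncard_union_le _ _).trans
    (Nat.add_le_add (ncard_incidences_isVertical_le P L) (ncard_incidences_lineOf_le P L))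

lemma ContainsConsistentGrid.containsNaturalGrid {t : ℕ} (ht : 0 < t) (hL : ∀ ℓ ∈ L, IsLine ℓ)
    (h : ContainsConsistentGrid t (dualPoints L) (dualLines P)) : ContainsNaturalGrid t P L := by
  obtain ⟨A, hA, B, hB, hAt, hBt, hcons, hcross⟩ := h
  have hAL : linesOf A ⊆ L := (Finset.map_subset_map.2 hA).trans (linesOf_dualPoints_subset L)
  have hBL : linesOf B ⊆ L := (Finset.map_subset_map.2 hB).trans (linesOf_dualPoints_subset L)
  refine ⟨linesOf A, linesOf B, hcons.isNaturalGrid ht hAt hBt (fun ℓ hℓ => hL ℓ (hAL hℓ))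
    fun ℓ hℓ => hL ℓ (hBL hℓ), hAL, hBL, ?_⟩
  rw [gridPoints_linesOf fun a ha b hb => hcons.fst_ne ha hb]
  rintro _ ⟨⟨a, b⟩, ⟨ha, hb⟩, rfl⟩
  obtain ⟨p, hp, hdual⟩ := mem_dualLines.1 (hcross a ha b hb)
  obtain rfl := coords.eq_symm_apply.2 (dual_injective hdual)
  exact hp

end Dual

end EuclideanPlane

theorem mainTheorem2_general {t : ℕ} (ht : 0 < t) :
    ∃ C : ℝ, 0 < C ∧ ∀ (P : Finset Plane) (L : Finset (AffineSubspace ℝ Plane)),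
      L.card ≤ P.card → (∀ ℓ ∈ L, IsLine ℓ) → ¬ContainsNaturalGrid t P L →
      ((incidences P L).ncard : ℝ) ≤ C * (P.card : ℝ) ^ ((4 : ℝ) / 3 - 1 / (18 * t)) := by
  obtain ⟨C, hC, hinc⟩ := exists_inc_le_rpow ℝ ht
  refine ⟨1 + C, by positivity, fun P L hPL hL hgrid => ?_⟩
  have hdual := hinc (dualPoints L) (dualLines P)
    ((card_dualPoints_le L).trans (hPL.trans (card_dualLines P).ge))
    (mt (ContainsConsistentGrid.containsNaturalGrid ht hL) hgrid)
  rw [card_dualLines] at hdual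
  have hexp : 1 / (18 * t : ℝ) ≤ 1 / 3 :=
    one_div_le_one_div_of_le (by norm_num) (by linarith [(Nat.one_le_cast (α := ℝ)).2 ht])
  have hvertical : (P.card : ℝ) ≤ (P.card : ℝ) ^ ((4 : ℝ) / 3 - 1 / (18 * t)) :=
    natCast_le_rpow _ (by linarith)
  have hsplit : ((incidences P L).ncard : ℝ) ≤ P.card + inc (dualPoints L) (dualLines P) :=
    mod_cast ncard_incidences_le hL
  linarith

theorem mainTheorem2 :
    ∃ ε : ℕ → ℝ,
      (∃ c : ℝ, 0 < c ∧ ∀ t : ℕ, 1 < t → c / (t : ℝ) ^ 2 ≤ ε t) ∧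
      ∀ t : ℕ, 1 < t → 0 < ε t ∧ ∃ C : ℝ, 0 < C ∧
        ∀ (n : ℕ) (P : Finset Plane) (L : Finset (AffineSubspace ℝ Plane)),
          P.card = n → L.card = n → (∀ ℓ ∈ L, IsLine ℓ) →
          ¬ ContainsNaturalGrid t P L →
          ((incidences P L).ncard : ℝ) ≤ C * (n : ℝ) ^ ((4 : ℝ) / 3 - ε t) := by
  refine ⟨fun t => 1 / (18 * t), ⟨1 / 18, by norm_num, fun t ht => ?_⟩, fun t ht => ?_⟩
  · rw [div_div]
    have ht' : (1 : ℝ) ≤ t := by exact_mod_cast ht.le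
    refine one_div_le_one_div_of_le (by positivity) (mul_le_mul_of_nonneg_left ?_ (by norm_num))
    exact le_self_pow₀ ht' two_ne_zero
  · have ht' := zero_lt_one.trans ht
    obtain ⟨C, hC, h⟩ := mainTheorem2_general ht'
    refine ⟨by positivity, C, hC, fun n P L hP hL => ?_⟩
    exact hP ▸ h P L (hL.trans hP.symm).le
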